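/- Theorem 1. A permutation $\sigma\in S_n$ is a shuffle if $\sigma(1)<\dots<\sigma(k)$ and $\sigma(k+1)<\dots<\sigma(n)$ for some $k$; the Lorenz vector of a shuffle $\sigma$ without fixed points is $\langle\sigma(1)-1,\dots,\sigma(k)-k\rangle$. For such a $\sigma$, the Lorenz link of $\sigma$ is the oriented closure of the permutation braid of $\sigma$: strands run from the $i$-th top point to the $\sigma(i)$-th bottom point, any two strands cross at most once, and at each crossing the strand going from left to right passes over (so all crossings are negative). The diagonal link of $\sigma$ is the oriented link given by the grid diagram with vertices $(i,i)$ and $(i,\sigma(i))$, $1\le i\le n$, whose vertical edges pass over the horizontal ones, the vertical edge with $x$-coordinate $i$ being oriented from $(i,i)$ to $(i,\sigma(i))$ and the horizontal edges accordingly. Then: (1) up to isotopy of oriented links in $\mathbb R^3$, the class of diagonal links coincides with the class of Lorenz links; (2) more precisely, for every fixed-point-free shuffle $\sigma$, the diagonal link of $\sigma$ is isotopic to the Lorenz link of $\sigma$. In particular, let $0<p_1<\dots<p_s$ and $q_1,\dots,q_s>0$ be integers, and let $\langle p_1^{q_1},\dots,p_s^{q_s}\rangle$ denote the vector in which each $p_i$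 is repeated $q_i$ times. There is exactly one fixed-point-free shuffle $\sigma$ (with $n$ not fixed in advance) that has this Lorenz vector, and its diagonal link $\mathrm{diag}(\langle p_1^{q_1},\dots,p_s^{q_s}\rangle)$ is isotopic to the Lorenz link $\langle p_1^{q_1},\dots,p_s^{q_s}\rangle$. -/

import Mathlib

/-- Three-dimensional space, with coordinates `(x, y, z)`. Only its topology and its affine
structure are used. In pictures the `z`-axis points towards the viewer. -/
abbrev Space : Type := ℝ × ℝ × ℝ

/-- An oriented (tame) link in `Space`, given as a disjoint union of finitely many simple closed
oriented polygons: `V` is the finite set of vertices, and an oriented straight edge leads from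
every vertex `a` to the vertex `next a`. The condition `embedded` says that the half-open edges
are non-degenerate and pairwise disjoint, i.e. that the union of circles obtained by
gluing the edges is embedded. -/
structure OrientedLink where
  /-- the set of vertices -/
  V : Type
  /-- there are finitely many vertices -/
  finite : Finite V
  /-- the vertex that follows a given one along the orientation -/
  next : Equiv.Perm V
  /-- the positions of the vertices -/
  pos : V → Space
  /-- the polygons are simple and disjoint -/
  embedded : ∀ a b : V, ∀ s ∈ Set.Ico (0 : ℝ) 1, ∀ t ∈ Set.Ico (0 : ℝ) 1,
    AffineMap.lineMap (pos a) (pos (next a)) s = AffineMap.lineMap (pos b) (pos (next b)) t →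
      a = b ∧ s = t

namespace OrientedLink

/-- The underlying point set of a link. -/
def support (L : OrientedLink) : Set Space :=
  ⋃ a : L.V, segment ℝ (L.pos a) (L.pos (L.next a))

/-- The infinite periodic traversal, along the orientation, of the component that contains the
vertex `a`: it is at `a` at time `0` and traverses one edge per unit of time. -/
noncomputable def traverse (L : OrientedLink) (a : L.V) (t : ℝ) : Space :=
  AffineMap.lineMap (L.pos ((L.next ^ ⌊t⌋) a)) (L.pos (L.next ((L.next ^ ⌊t⌋) a))) (Int.fract t)

/-- Isotopy of oriented links: there is an ambient isotopy `H` of space, starting at the identity,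
whose final homeomorphism carries `L` onto `L'` and respects the orientations. The last clause
says that it carries the traversal of each component of `L` to the traversal of a component
of `L'`, up to a strictly increasing change of parameter. -/
def Isotopic (L L' : OrientedLink) : Prop :=
  ∃ H : unitInterval → Space → Space,
    Continuous (Function.uncurry H) ∧ (∀ t, IsHomeomorph (H t)) ∧ H 0 = id ∧
    H 1 '' L.support = L'.support ∧
    ∀ a : L.V, ∃ b : L'.V, ∃ φ : ℝ ≃o ℝ, ∀ t : ℝ,
      H 1 (L.traverse a t) = L'.traverse b (φ t)

end OrientedLink

/-- The cyclic order of the vertices of closed polygons that are composed of arcs with four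
vertices each, where the arc `i` is followed by the arc `σ i`:
`(i, 0) → (i, 1) → (i, 2) → (i, 3) → (σ i, 0)`. -/
def arcNext {n : ℕ} (σ : Equiv.Perm (Fin n)) : Equiv.Perm (Fin n × Fin 4) where
  toFun a := if a.2 = 3 then (σ a.1, 0) else (a.1, a.2 + 1)
  invFun a := if a.2 = 0 then (σ.symm a.1, 3) else (a.1, a.2 - 1)
  left_inv := by
    rintro ⟨i, j⟩
    fin_cases j <;> simp
  right_inv := by
    rintro ⟨i, j⟩
    fin_cases j <;> simp

/-- The points of an edge, in coordinates. -/
theorem lineMap_coords (p q : Space) (t : ℝ) :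
    AffineMap.lineMap p q t = ((p.1 + t * (q.1 - p.1), p.2.1 + t * (q.2.1 - p.2.1),
      p.2.2 + t * (q.2.2 - p.2.2)) : Space) := by
  ext <;> simp [AffineMap.lineMap_apply] <;> ring

/-- An affine function with different values at `0` and `1` takes its value at `1` only there. -/
theorem eq_of_half_open {a b t : ℝ} (ht : t < 1) (h : a + t * (b - a) = b) : a = b := by
  have h1 : (1 - t) * (a - b) = 0 := by linarith
  rcases mul_eq_zero.1 h1 with h2 | h2 <;> linarith

/-- A non-constant affine function is injective. -/
theorem eq_of_affine {a b s t : ℝ} (hab : a ≠ b) (h : a + s * (b - a) = a + t * (b - a)) :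
    s = t := by
  have h1 : (s - t) * (b - a) = 0 := by linarith
  rcases mul_eq_zero.1 h1 with h2 | h2
  · linarith
  · exact absurd (by linarith) hab

/-- Indices are determined by their values as real numbers. -/
theorem fin_eq_of_cast {n : ℕ} {i j : Fin n} (h : ((i : ℕ) : ℝ) = ((j : ℕ) : ℝ)) : i = j :=
  Fin.ext (Nat.cast_injective h)

/-- An oriented grid (rectangular) diagram of size `n`: the column `x = i` contains the two
vertices `(i, start i)` and `(i, finish i)`, joined by a vertical edge oriented from the former
to the latter; each row `y = j` contains the two vertices `(finish⁻¹ j, j)` and `(start⁻¹ j, j)`,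
joined by a horizontal edge oriented from the former to the latter. -/
structure GridDiagram where
  /-- the size of the grid -/
  n : ℕ
  /-- heights of the initial points of the vertical edges -/
  start : Equiv.Perm (Fin n)
  /-- heights of the final points of the vertical edges -/
  finish : Equiv.Perm (Fin n)
  /-- no vertical edge is degenerate -/
  start_ne_finish : ∀ i, start i ≠ finish i

namespace GridDiagram

/-- The spatial positions of the vertices: the vertical edges of the diagram are at
height `z = 1`, the horizontal edges at height `z = 0`. -/
def pos (G : GridDiagram) : Fin G.n × Fin 4 → Space
  | (i, 0) => ((i : ℕ), (G.start i : ℕ), 0)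
  | (i, 1) => ((i : ℕ), (G.start i : ℕ), 1)
  | (i, 2) => ((i : ℕ), (G.finish i : ℕ), 1)
  | (i, 3) => ((i : ℕ), (G.finish i : ℕ), 0)

/-- The oriented link presented by a grid diagram: vertical edges pass over horizontal edges. -/
def link (G : GridDiagram) : OrientedLink where
  V := Fin G.n × Fin 4
  finite := inferInstance
  next := arcNext (G.finish.trans G.start.symm)
  pos := G.pos
  embedded := by
    rintro ⟨i, j⟩ ⟨i', j'⟩ s ⟨hs0, hs1⟩ t ⟨ht0, ht1⟩ h
    rw [lineMap_coords, lineMap_coords, Prod.mk.injEq, Prod.mk.injEq] at h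
    obtain ⟨hx, hy, hz⟩ := h
    fin_cases j <;> fin_cases j' <;> simp [arcNext, pos] at hx hy hz ⊢
    · exact ⟨Fin.ext hx, hz⟩
    · linarith
    · obtain rfl : i = i' := Fin.ext hx
      exact G.start_ne_finish i (Fin.ext hy)
    · rw [← (Fin.ext hy : G.start i = G.finish i'), Equiv.symm_apply_apply] at hx
      obtain rfl := fin_eq_of_cast (eq_of_half_open ht1 hx.symm)
      exact G.start_ne_finish _ (Fin.ext hy)
    · linarith
    · obtain rfl : i = i' := Fin.ext hx
      exact ⟨rfl, eq_of_affine (fun h => G.start_ne_finish i (fin_eq_of_cast h)) hy⟩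
    · obtain rfl : i = i' := Fin.ext hx
      exact G.start_ne_finish i (fin_eq_of_cast (eq_of_half_open hs1 hy))
    · obtain rfl : i = i' := Fin.ext hx
      exact G.start_ne_finish i (Fin.ext hy.symm)
    · obtain rfl : i = i' := Fin.ext hx
      exact G.start_ne_finish i (fin_eq_of_cast (eq_of_half_open ht1 hy.symm))
    · exact ⟨Fin.ext hx, hz⟩
    · linarith
    · rw [(Fin.ext hy : G.finish i = G.start i'), Equiv.symm_apply_apply] at hx
      obtain rfl := fin_eq_of_cast (eq_of_half_open hs1 hx)
      exact G.start_ne_finish _ (Fin.ext hy.symm)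
    · linarith
    · obtain rfl : i = i' := G.finish.injective (Fin.ext hy)
      refine ⟨rfl, eq_of_affine (fun h => G.start_ne_finish i ?_) hx⟩
      rw [← G.start.eq_symm_apply.1 (fin_eq_of_cast h)]

end GridDiagram

/-- The positions of the vertices of the closed permutation braid of `σ`. The strand `i` is the
straight segment from `(i, 1)` to `(σ i, 0)`, at the height `z = n - i` (so strands further to the
left at the top pass over strands further to the right); the closing segments, from `(m, 0)` back
to `(m, 1)`, are parallel and lie behind all strands, at the height `z = 0`. -/
def permBraidPos {n : ℕ} (σ : Equiv.Perm (Fin n)) : Fin n × Fin 4 → Space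
  | (i, 0) => ((i : ℕ), 1, 0)
  | (i, 1) => ((i : ℕ), 1, (n : ℝ) - (i : ℕ))
  | (i, 2) => ((σ i : ℕ), 0, (n : ℝ) - (i : ℕ))
  | (i, 3) => ((σ i : ℕ), 0, 0)

/-- The closure of the permutation braid associated to `σ`: the strand that starts at the `i`-th
point ends at the `σ i`-th point, any two strands cross at most once, and all crossings have the
same sign, namely, the strand that goes from left to right passes over. The link is oriented
along the strands, from the top `y = 1` to the bottom `y = 0`. -/
def closedPermBraid {n : ℕ} (σ : Equiv.Perm (Fin n)) : OrientedLink where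
  V := Fin n × Fin 4
  finite := inferInstance
  next := arcNext σ
  pos := permBraidPos σ
  embedded := by
    rintro ⟨i, j⟩ ⟨i', j'⟩ s ⟨hs0, hs1⟩ t ⟨ht0, ht1⟩ h
    rw [lineMap_coords, lineMap_coords, Prod.mk.injEq, Prod.mk.injEq] at h
    obtain ⟨hx, hy, hz⟩ := h
    have hi : ((i : ℕ) : ℝ) < n := Nat.cast_lt.2 i.2
    have hi' : ((i' : ℕ) : ℝ) < n := Nat.cast_lt.2 i'.2
    fin_cases j <;> fin_cases j' <;> simp [arcNext, permBraidPos] at hx hy hz ⊢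
    · obtain rfl : i = i' := Fin.ext hx
      exact ⟨rfl, mul_right_cancel₀ (by linarith) hz⟩
    · obtain rfl : i = i' := fin_eq_of_cast (by rw [hx, hy]; ring)
      nlinarith
    · linarith
    · obtain rfl : i = i' := fin_eq_of_cast (by rw [← hx, hy]; ring)
      nlinarith
    · exact ⟨Fin.ext hz, hy⟩
    · linarith
    · linarith
    · linarith
    · obtain rfl : i = i' := σ.injective (Fin.ext hx)
      exact ⟨rfl, mul_right_cancel₀ (b := ((i : ℕ) : ℝ) - n) (by linarith) (by linarith)⟩
    · nlinarith
    · linarith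
    · linarith
    · nlinarith
    · exact ⟨σ.injective (Fin.ext hx), hy⟩

/-- `σ` is increasing on the first `k` elements and on the remaining ones. -/
def IsShuffleAt {n : ℕ} (σ : Equiv.Perm (Fin n)) (k : ℕ) : Prop :=
  k ≤ n ∧ (∀ i j : Fin n, i < j → (j : ℕ) < k → σ i < σ j) ∧
    (∀ i j : Fin n, i < j → k ≤ (i : ℕ) → σ i < σ j)

/-- A shuffle without fixed points. -/
structure LorenzShuffle where
  /-- the number of permuted elements -/
  n : ℕ
  /-- the permutation -/
  perm : Equiv.Perm (Fin n)
  /-- it is a shuffle -/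
  shuffle : ∃ k, IsShuffleAt perm k
  /-- it has no fixed points -/
  perm_ne : ∀ i, perm i ≠ i

namespace LorenzShuffle

/-- `v` is the Lorenz vector `⟨σ(1) - 1, …, σ(k) - k⟩` of `σ`. -/
def HasVector (σ : LorenzShuffle) (v : List ℤ) : Prop :=
  ∃ k, IsShuffleAt σ.perm k ∧
    v = (List.ofFn fun i : Fin σ.n => ((σ.perm i : ℕ) : ℤ) - ((i : ℕ) : ℤ)).take k

/-- The Lorenz link of `σ`: the closure of the permutation braid of `σ`. -/
def lorenzLink (σ : LorenzShuffle) : OrientedLink := closedPermBraid σ.perm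

/-- The grid diagram with the vertices `(i, i)` and `(i, σ i)`, whose vertical edges are oriented
from `(i, i)` to `(i, σ i)`. -/
def grid (σ : LorenzShuffle) : GridDiagram where
  n := σ.n
  start := Equiv.refl _
  finish := σ.perm
  start_ne_finish i := (σ.perm_ne i).symm

/-- The diagonal link of `σ`. -/
def diagonalLink (σ : LorenzShuffle) : OrientedLink := σ.grid.link

end LorenzShuffle

/-- `L` is a Lorenz link (up to isotopy). -/
def IsLorenzLink (L : OrientedLink) : Prop :=
  ∃ σ : LorenzShuffle, L.Isotopic σ.lorenzLink

/-- `L` is a diagonal link (up to isotopy). -/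
def IsDiagonalLink (L : OrientedLink) : Prop :=
  ∃ σ : LorenzShuffle, L.Isotopic σ.diagonalLink

/-- The vector `⟨p₁^q₁, …, pₛ^qₛ⟩`, in which each `pᵢ` is repeated `qᵢ` times. -/
def powerVector {s : ℕ} (p q : Fin s → ℕ) : List ℤ :=
  (List.ofFn fun i => List.replicate (q i) (p i : ℤ)).flatten

/-!
The diagonal link and the Lorenz link of a fixed-point-free shuffle `σ` are polygons with the same
combinatorial structure: one arc with four vertices for every index `i`, followed by the arc `σ i`.
The isotopy moves the vertices so that the polygons stay embedded.

*From moving polygons to ambient isotopies* (`carriedTo_of_path`). While the vertices move a little,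
the displacement of the points of an embedded polygon is Lipschitz with a constant less than `1`;
by compactness the admissible step size is uniform in the time (`exists_displacement_bound`). Such a
displacement extends to a Lipschitz vector field `u` on space with the same constant, and
`x ↦ x + t u(x)`, `0 ≤ t ≤ 1`, is an ambient isotopy. Finitely many steps are composed. As the
isotopy is affine on each edge, it also respects the parametrizations of the components.

*The motion.* In the coordinates `(y, y - x, z)` the diagonal becomes the line `y = 0`, and the arc
`i` of the diagonal link is a hook
`(i, 0, 0) → (i, 0, 1) → (σ i, σ i - i, 1) → (σ i, σ i - i, 0) → (σ i, 0, 0)`,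
which lies in `y > 0` if `i < σ i` and in `y < 0` if `σ i < i`. The closed permutation braid has the
same shape, with the levels `n - i` instead of `1` and with all hooks in `y < 0`. So the hooks with
`i < σ i` have to be moved from `y > 0` to `y < 0`. After the levels have been separated
(`raisePos`), they are pulled over the right end of the diagram, where they become nested
`C`-shaped curves: the vertex `(σ i, _, n - i)` is moved to `(2 n - i, _, 0)`, and the vertex
`(σ i, _, 0)` is lowered so that the two long edges have the slopes `∓ 1 / 2` in the projection to
the `xz`-plane. In this projection the curves are disjoint from each other and from all the other
arcs, so they can be pushed through the plane `y = 0`; this depends on `σ` being increasing on both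
blocks. Afterwards they are narrowed again in `y < 0` (`sweepPos`), and the widths are made equal
(`levelPos`).

*Lorenz vectors.* The vector gives the values of `σ` on the first block. The largest value is
attained at the end of the first block, for otherwise it would be attained at a fixed point, so `n`
is determined; the values on the second block are the remaining ones in increasing order.
-/

/-! ### Ambient isotopies of space -/

/-- `Φ` is the final homeomorphism of an ambient isotopy of space that starts at the identity. -/
def IsAmbientIsotopyEnd (Φ : Space → Space) : Prop :=
  ∃ H : unitInterval → Space → Space,
    Continuous (Function.uncurry H) ∧ (∀ t, IsHomeomorph (H t)) ∧ H 0 = id ∧ H 1 = Φ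

theorem IsAmbientIsotopyEnd.id : IsAmbientIsotopyEnd id :=
  ⟨fun _ => _root_.id, continuous_snd, fun _ => (Homeomorph.refl _).isHomeomorph, rfl, rfl⟩

theorem IsAmbientIsotopyEnd.comp {Φ Ψ : Space → Space} (hΨ : IsAmbientIsotopyEnd Ψ)
    (hΦ : IsAmbientIsotopyEnd Φ) : IsAmbientIsotopyEnd (Ψ ∘ Φ) := by
  obtain ⟨H, hH, hh, h0, h1⟩ := hΦ
  obtain ⟨K, hK, hk, k0, k1⟩ := hΨ
  refine ⟨fun t => K t ∘ H t, ?_, fun t => (hk t).comp (hh t), by simp [h0, k0], by simp [h1, k1]⟩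
  exact hK.comp (continuous_fst.prodMk hH)

/-- A displacement field with a Lipschitz constant `κ < 1` is the end of the ambient isotopy that
multiplies the displacement by the time. -/
theorem isAmbientIsotopyEnd_add_of_lipschitz {u : Space → Space} {κ : NNReal} (hκ : κ < 1)
    (hu : LipschitzWith κ u) : IsAmbientIsotopyEnd (fun x => x + u x) := by
  refine ⟨fun t x => x + (t : ℝ) • u x, ?_, fun t => ?_, ?_, ?_⟩
  · have := hu.continuous
    unfold Function.uncurry
    fun_prop
  · have h : ApproximatesLinearOn (fun x => x + (t : ℝ) • u x)
        ((ContinuousLinearEquiv.refl ℝ Space : Space ≃L[ℝ] Space) : Space →L[ℝ] Space)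
        Set.univ κ := by
      intro x _ y _
      have e : x + (t : ℝ) • u x - (y + (t : ℝ) • u y) -
          ((ContinuousLinearEquiv.refl ℝ Space : Space ≃L[ℝ] Space) : Space →L[ℝ] Space) (x - y)
          = (t : ℝ) • (u x - u y) := by
        simp only [ContinuousLinearEquiv.coe_refl, ContinuousLinearMap.coe_id', id_eq, smul_sub]
        abel
      rw [e, norm_smul, Real.norm_of_nonneg t.2.1]
      calc (t : ℝ) * ‖u x - u y‖ ≤ 1 * ‖u x - u y‖ :=
            mul_le_mul_of_nonneg_right t.2.2 (norm_nonneg _)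
        _ ≤ κ * ‖x - y‖ := by
            rw [one_mul, ← dist_eq_norm, ← dist_eq_norm]
            exact hu.dist_le_mul x y
    have hc : κ < ‖((ContinuousLinearEquiv.refl ℝ Space).symm : Space →L[ℝ] Space)‖₊⁻¹ := by
      have e : ‖((ContinuousLinearEquiv.refl ℝ Space).symm : Space →L[ℝ] Space)‖₊ = 1 := by
        rw [ContinuousLinearEquiv.refl_symm, ContinuousLinearEquiv.coe_refl]
        exact NNReal.eq ContinuousLinearMap.norm_id
      rw [e, inv_one]
      exact hκ
    exact (h.toHomeomorph _ (Or.inr hc)).isHomeomorph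
  · ext x <;> simp
  · ext x <;> simp

/-- A Lipschitz map into space, defined on a subset, extends with the same constant, because the
norm of `Space` is the supremum norm. -/
theorem LipschitzOnWith.extend_space {s : Set Space} {f : Space → Space} {κ : NNReal}
    (hf : LipschitzOnWith κ f s) : ∃ g : Space → Space, LipschitzWith κ g ∧ Set.EqOn f g s := by
  have h1 : LipschitzOnWith κ (fun x => (f x).1) s := fun x hx y hy =>
    (le_max_left _ _).trans (hf hx hy)
  have h23 : LipschitzOnWith κ (fun x => (f x).2) s := fun x hx y hy =>
    (le_max_right _ _).trans (hf hx hy)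
  have h2 : LipschitzOnWith κ (fun x => (f x).2.1) s := fun x hx y hy =>
    (le_max_left _ _).trans (h23 hx hy)
  have h3 : LipschitzOnWith κ (fun x => (f x).2.2) s := fun x hx y hy =>
    (le_max_right _ _).trans (h23 hx hy)
  obtain ⟨g1, hg1, e1⟩ := h1.extend_real
  obtain ⟨g2, hg2, e2⟩ := h2.extend_real
  obtain ⟨g3, hg3, e3⟩ := h3.extend_real
  refine ⟨fun x => (g1 x, g2 x, g3 x), fun x y => ?_, fun x hx => ?_⟩
  · exact max_le (hg1 x y) (max_le (hg2 x y) (hg3 x y))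
  · exact Prod.ext (e1 hx) (Prod.ext (e2 hx) (e3 hx))

/-! ### Embedded polygons -/

section Polygons

variable {V : Type} {next : Equiv.Perm V}

/-- The point with parameter `s` on the edge that starts at the vertex `a`, for the closed polygons
with the vertex positions `P`. -/
def edgePoint (next : Equiv.Perm V) (P : V → Space) (a : V) (s : ℝ) : Space :=
  AffineMap.lineMap (P a) (P (next a)) s

/-- The condition on the vertex positions `P` that is required of an `OrientedLink`. -/
def IsEmbedded (next : Equiv.Perm V) (P : V → Space) : Prop :=
  ∀ a b : V, ∀ s ∈ Set.Ico (0 : ℝ) 1, ∀ t ∈ Set.Ico (0 : ℝ) 1,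
    edgePoint next P a s = edgePoint next P b t → a = b ∧ s = t

theorem edgePoint_eq (P : V → Space) (a : V) (s : ℝ) :
    edgePoint next P a s = P a + s • (P (next a) - P a) := by
  rw [edgePoint, AffineMap.lineMap_apply, vsub_eq_sub, vadd_eq_add, add_comm]

theorem edgePoint_sub (P Q : V → Space) (a : V) (s : ℝ) :
    edgePoint next (P - Q) a s = edgePoint next P a s - edgePoint next Q a s := by
  simp only [edgePoint_eq, Pi.sub_apply, smul_sub]
  abel

theorem edgePoint_zero (P : V → Space) (a : V) : edgePoint next P a 0 = P a := by
  simp [edgePoint]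

theorem edgePoint_one (P : V → Space) (a : V) : edgePoint next P a 1 = P (next a) := by
  simp [edgePoint]

theorem norm_edgePoint_le {Q : V → Space} {M : ℝ} (hQ : ∀ v, ‖Q v‖ ≤ M) (a : V) {s : ℝ}
    (hs : s ∈ Set.Icc (0 : ℝ) 1) : ‖edgePoint next Q a s‖ ≤ M := by
  have e : edgePoint next Q a s = (1 - s) • Q a + s • Q (next a) := by
    rw [edgePoint, AffineMap.lineMap_apply_module]
  calc ‖edgePoint next Q a s‖ ≤ ‖(1 - s) • Q a‖ + ‖s • Q (next a)‖ := e ▸ norm_add_le _ _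
    _ = (1 - s) * ‖Q a‖ + s * ‖Q (next a)‖ := by
        rw [norm_smul, norm_smul, Real.norm_of_nonneg hs.1,
          Real.norm_of_nonneg (by linarith [hs.2])]
    _ ≤ (1 - s) * M + s * M :=
        add_le_add (mul_le_mul_of_nonneg_left (hQ _) (by linarith [hs.2]))
          (mul_le_mul_of_nonneg_left (hQ _) hs.1)
    _ = M := by ring

namespace IsEmbedded

variable {P : V → Space}

theorem pos_ne_next (h : IsEmbedded next P) (a : V) : P a ≠ P (next a) := by
  intro e
  have := (h a a 0 (by norm_num) (1 / 2) (by norm_num) (by simp [edgePoint_eq, e])).2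
  norm_num at this

theorem next_ne (h : IsEmbedded next P) (a : V) : next a ≠ a :=
  fun e => h.pos_ne_next a (by rw [e])

/-- Closed edges without a common vertex are disjoint. -/
theorem edgePoint_ne (h : IsEmbedded next P) {a b : V} (hab : a ≠ b) (h1 : b ≠ next a)
    (h2 : a ≠ next b) {s t : ℝ} (hs : s ∈ Set.Icc (0 : ℝ) 1) (ht : t ∈ Set.Icc (0 : ℝ) 1) :
    edgePoint next P a s ≠ edgePoint next P b t := by
  intro e
  have z : (0 : ℝ) ∈ Set.Ico (0 : ℝ) 1 := by norm_num
  rcases hs.2.lt_or_eq with hs1 | rfl <;> rcases ht.2.lt_or_eq with ht1 | rfl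
  · exact hab (h a b s ⟨hs.1, hs1⟩ t ⟨ht.1, ht1⟩ e).1
  · rw [edgePoint_one, ← edgePoint_zero (next := next) P (next b)] at e
    exact h2 (h a (next b) s ⟨hs.1, hs1⟩ 0 z e).1
  · rw [edgePoint_one, ← edgePoint_zero (next := next) P (next a)] at e
    exact h1 (h (next a) b 0 z t ⟨ht.1, ht1⟩ e).1.symm
  · rw [edgePoint_one, edgePoint_one, ← edgePoint_zero (next := next) P (next a),
      ← edgePoint_zero (next := next) P (next b)] at e
    exact hab (next.injective (h (next a) (next b) 0 z 0 z e).1)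

/-- Consecutive edges do not leave their common vertex in the same direction. -/
theorem smul_ne_smul (h : IsEmbedded next P) (a : V) {α β : ℝ} (hα : 0 ≤ α) (hβ : 0 ≤ β)
    (hαβ : α + β = 1) :
    α • (P a - P (next a)) ≠ β • (P (next (next a)) - P (next a)) := by
  intro e
  rcases hα.eq_or_lt with rfl | hα
  · obtain rfl : β = 1 := by linarith
    rw [zero_smul, one_smul] at e
    exact h.pos_ne_next (next a) (sub_eq_zero.1 e.symm).symm
  rcases hβ.eq_or_lt with rfl | hβ
  · obtain rfl : α = 1 := by linarith
    rw [zero_smul, one_smul] at e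
    exact h.pos_ne_next a (sub_eq_zero.1 e)
  refine h.next_ne a (h a (next a) (1 - α) ⟨by linarith, by linarith⟩ β ⟨hβ.le, by linarith⟩ ?_).1.symm
  rw [edgePoint_eq, edgePoint_eq, ← e]
  module

end IsEmbedded

variable {F : ℝ → V → Space}

theorem continuous_edgePoint (hF : ∀ v, Continuous fun t => F t v) (a : V) :
    Continuous fun x : ℝ × ℝ => edgePoint next (F x.1) a x.2 := by
  simp only [edgePoint_eq]
  have h1 : Continuous fun x : ℝ × ℝ => F x.1 a := (hF a).comp continuous_fst
  have h2 : Continuous fun x : ℝ × ℝ => F x.1 (next a) := (hF (next a)).comp continuous_fst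
  fun_prop

/-- A continuous function without zeros on a compact set is bounded away from zero. -/
theorem exists_pos_le_norm {X : Type*} [TopologicalSpace X] {K : Set X} (hK : IsCompact K)
    {f : X → Space} (hf : Continuous f) (h : ∀ x ∈ K, f x ≠ 0) : ∃ c > 0, ∀ x ∈ K, c ≤ ‖f x‖ := by
  rcases K.eq_empty_or_nonempty with rfl | hne
  · exact ⟨1, one_pos, by simp⟩
  · obtain ⟨x, hx, hmin⟩ := hK.exists_isMinOn hne hf.norm.continuousOn
    exact ⟨‖f x‖, norm_pos_iff.2 (h x hx), fun y hy => hmin hy⟩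

/-- The estimate of `exists_displacement_bound` for consecutive edges. -/
theorem exists_displacement_bound_next (hF : ∀ v, Continuous fun t => F t v)
    (he : ∀ t ∈ Set.Icc (0 : ℝ) 1, IsEmbedded next (F t)) (a : V) :
    ∃ C : ℝ, 0 ≤ C ∧ ∀ t ∈ Set.Icc (0 : ℝ) 1, ∀ (Q : V → Space) (M : ℝ), (∀ v, ‖Q v‖ ≤ M) →
      ∀ s ∈ Set.Icc (0 : ℝ) 1, ∀ s' ∈ Set.Icc (0 : ℝ) 1,
        ‖edgePoint next Q a s - edgePoint next Q (next a) s'‖ ≤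
          C * M * ‖edgePoint next (F t) a s - edgePoint next (F t) (next a) s'‖ := by
  -- With `α = 1 - s` and `β = s'`, both differences are linear in `(α, β)`, so that it suffices to
  -- bound the right one from below for `α + β = 1`.
  have key : ∀ (Q : V → Space) (s s' : ℝ),
      edgePoint next Q a s - edgePoint next Q (next a) s' =
        (1 - s) • (Q a - Q (next a)) - s' • (Q (next (next a)) - Q (next a)) := by
    intro Q s s'
    rw [edgePoint_eq, edgePoint_eq]
    module
  obtain ⟨c, hc, hb⟩ := exists_pos_le_norm
    (K := Set.Icc (0 : ℝ) 1 ×ˢ Set.Icc (0 : ℝ) 1) (isCompact_Icc.prod isCompact_Icc)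
    (f := fun x => x.2 • (F x.1 a - F x.1 (next a)) -
      (1 - x.2) • (F x.1 (next (next a)) - F x.1 (next a)))
    (by
      have h1 : Continuous fun x : ℝ × ℝ => F x.1 a := (hF a).comp continuous_fst
      have h2 : Continuous fun x : ℝ × ℝ => F x.1 (next a) := (hF (next a)).comp continuous_fst
      have h3 : Continuous fun x : ℝ × ℝ => F x.1 (next (next a)) :=
        (hF (next (next a))).comp continuous_fst
      fun_prop)
    (fun x hx => sub_ne_zero.2 ((he x.1 hx.1).smul_ne_smul a hx.2.1 (by linarith [hx.2.2])
      (by ring)))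
  refine ⟨2 / c, by positivity, fun t ht Q M hQ s hs s' hs' => ?_⟩
  have hM : 0 ≤ M := (norm_nonneg _).trans (hQ a)
  have hα : 0 ≤ 1 - s := by linarith [hs.2]
  have hlow : c * (1 - s + s') ≤
      ‖edgePoint next (F t) a s - edgePoint next (F t) (next a) s'‖ := by
    rw [key]
    rcases (add_nonneg hα hs'.1).eq_or_lt with h0 | h0
    · rw [← h0, mul_zero]
      exact norm_nonneg _
    have hm : (1 - s) / (1 - s + s') ∈ Set.Icc (0 : ℝ) 1 :=
      ⟨by positivity, by rw [div_le_one h0]; linarith [hs'.1]⟩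
    have h1 := hb (t, (1 - s) / (1 - s + s')) ⟨ht, hm⟩
    have h2 : 1 - (1 - s) / (1 - s + s') = s' / (1 - s + s') := by
      field_simp
      ring
    simp only [h2] at h1
    have h3 : (1 - s) • (F t a - F t (next a)) - s' • (F t (next (next a)) - F t (next a)) =
        (1 - s + s') • (((1 - s) / (1 - s + s')) • (F t a - F t (next a)) -
          (s' / (1 - s + s')) • (F t (next (next a)) - F t (next a))) := by
      rw [smul_sub (1 - s + s'), smul_smul, smul_smul, mul_div_cancel₀ _ h0.ne', mul_div_cancel₀ _ h0.ne']
    rw [h3, norm_smul, Real.norm_of_nonneg h0.le, mul_comm c]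
    exact mul_le_mul_of_nonneg_left h1 h0.le
  have hup : ‖edgePoint next Q a s - edgePoint next Q (next a) s'‖ ≤ (1 - s + s') * (2 * M) := by
    rw [key]
    have d : ∀ v w, ‖Q v - Q w‖ ≤ 2 * M := fun v w =>
      (norm_sub_le _ _).trans (by linarith [hQ v, hQ w])
    calc _ ≤ ‖(1 - s) • (Q a - Q (next a))‖ + ‖s' • (Q (next (next a)) - Q (next a))‖ :=
          norm_sub_le _ _
      _ ≤ (1 - s) * (2 * M) + s' * (2 * M) := by
          rw [norm_smul, norm_smul, Real.norm_of_nonneg hα, Real.norm_of_nonneg hs'.1]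
          exact add_le_add (mul_le_mul_of_nonneg_left (d _ _) hα)
            (mul_le_mul_of_nonneg_left (d _ _) hs'.1)
      _ = _ := by ring
  calc _ ≤ (1 - s + s') * (2 * M) := hup
    _ = 2 / c * M * (c * (1 - s + s')) := by
        field_simp
    _ ≤ _ := mul_le_mul_of_nonneg_left hlow (by positivity)

/-- The estimate of `exists_displacement_bound` for two given edges. -/
theorem exists_displacement_bound_pair (hF : ∀ v, Continuous fun t => F t v)
    (he : ∀ t ∈ Set.Icc (0 : ℝ) 1, IsEmbedded next (F t)) (a b : V) :
    ∃ C : ℝ, 0 ≤ C ∧ ∀ t ∈ Set.Icc (0 : ℝ) 1, ∀ (Q : V → Space) (M : ℝ), (∀ v, ‖Q v‖ ≤ M) →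
      ∀ s ∈ Set.Icc (0 : ℝ) 1, ∀ s' ∈ Set.Icc (0 : ℝ) 1,
        ‖edgePoint next Q a s - edgePoint next Q b s'‖ ≤
          C * M * ‖edgePoint next (F t) a s - edgePoint next (F t) b s'‖ := by
  by_cases h1 : b = next a
  · rw [h1]
    exact exists_displacement_bound_next hF he a
  by_cases h2 : a = next b
  · obtain ⟨C, hC, h⟩ := exists_displacement_bound_next hF he b
    refine ⟨C, hC, fun t ht Q M hQ s hs s' hs' => ?_⟩
    rw [norm_sub_rev, norm_sub_rev (edgePoint next (F t) a s), h2]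
    exact h t ht Q M hQ s' hs' s hs
  by_cases hab : a = b
  · subst hab
    have key : ∀ (Q : V → Space) (s s' : ℝ),
        ‖edgePoint next Q a s - edgePoint next Q a s'‖ = |s - s'| * ‖Q (next a) - Q a‖ := by
      intro Q s s'
      rw [← Real.norm_eq_abs, ← norm_smul, edgePoint_eq, edgePoint_eq]
      congr 1
      module
    obtain ⟨c, hc, hb⟩ := exists_pos_le_norm (isCompact_Icc (a := (0 : ℝ)) (b := 1))
      (f := fun t => F t (next a) - F t a) ((hF _).sub (hF _))
      (fun t ht => sub_ne_zero.2 ((he t ht).pos_ne_next a).symm)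
    refine ⟨2 / c, by positivity, fun t ht Q M hQ s _ s' _ => ?_⟩
    have hM : 0 ≤ M := (norm_nonneg _).trans (hQ a)
    rw [key, key]
    calc |s - s'| * ‖Q (next a) - Q a‖ ≤ |s - s'| * (2 * M) :=
          mul_le_mul_of_nonneg_left ((norm_sub_le _ _).trans (by linarith [hQ a, hQ (next a)]))
            (abs_nonneg _)
      _ = 2 / c * M * (|s - s'| * c) := by field_simp
      _ ≤ _ := mul_le_mul_of_nonneg_left (mul_le_mul_of_nonneg_left (hb t ht) (abs_nonneg _))
            (by positivity)
  · obtain ⟨c, hc, hb⟩ := exists_pos_le_norm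
      (K := Set.Icc (0 : ℝ) 1 ×ˢ Set.Icc (0 : ℝ) 1 ×ˢ Set.Icc (0 : ℝ) 1)
      (isCompact_Icc.prod (isCompact_Icc.prod isCompact_Icc))
      (f := fun x => edgePoint next (F x.1) a x.2.1 - edgePoint next (F x.1) b x.2.2)
      (((continuous_edgePoint hF a).comp
          (continuous_fst.prodMk (continuous_fst.comp continuous_snd))).sub
        ((continuous_edgePoint hF b).comp
          (continuous_fst.prodMk (continuous_snd.comp continuous_snd))))
      (fun x hx => sub_ne_zero.2 ((he x.1 hx.1).edgePoint_ne hab h1 h2 hx.2.1 hx.2.2))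
    refine ⟨2 / c, by positivity, fun t ht Q M hQ s hs s' hs' => ?_⟩
    have hM : 0 ≤ M := (norm_nonneg _).trans (hQ a)
    calc ‖edgePoint next Q a s - edgePoint next Q b s'‖ ≤ 2 * M :=
          (norm_sub_le _ _).trans
            (by linarith [norm_edgePoint_le (next := next) hQ a hs,
              norm_edgePoint_le (next := next) hQ b hs'])
      _ = 2 / c * M * c := by field_simp
      _ ≤ _ := mul_le_mul_of_nonneg_left (hb (t, s, s') ⟨ht, hs, hs'⟩) (by positivity)

/-- Along a continuous path of embedded polygons, the displacement of the points of the polygon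
that is caused by a displacement `Q` of the vertices is Lipschitz on the polygon, with a constant
that is proportional to the size of `Q` and uniform in the time. -/
theorem exists_displacement_bound [Finite V] (hF : ∀ v, Continuous fun t => F t v)
    (he : ∀ t ∈ Set.Icc (0 : ℝ) 1, IsEmbedded next (F t)) :
    ∃ C : ℝ, 0 ≤ C ∧ ∀ t ∈ Set.Icc (0 : ℝ) 1, ∀ (Q : V → Space) (M : ℝ), (∀ v, ‖Q v‖ ≤ M) →
      ∀ a b, ∀ s ∈ Set.Icc (0 : ℝ) 1, ∀ s' ∈ Set.Icc (0 : ℝ) 1,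
        ‖edgePoint next Q a s - edgePoint next Q b s'‖ ≤
          C * M * ‖edgePoint next (F t) a s - edgePoint next (F t) b s'‖ := by
  cases nonempty_fintype V
  choose C hC h using exists_displacement_bound_pair hF he
  refine ⟨∑ a, ∑ b, C a b, Finset.sum_nonneg fun a _ => Finset.sum_nonneg fun b _ => hC a b,
    fun t ht Q M hQ a b s hs s' hs' => (h a b t ht Q M hQ s hs s' hs').trans ?_⟩
  have hM : 0 ≤ M := (norm_nonneg _).trans (hQ a)
  have hle : C a b ≤ ∑ a, ∑ b, C a b :=
    (Finset.single_le_sum (f := fun b => C a b) (fun b _ => hC a b) (Finset.mem_univ b)).trans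
      (Finset.single_le_sum (f := fun a => ∑ b, C a b)
        (fun a _ => Finset.sum_nonneg fun b _ => hC a b) (Finset.mem_univ a))
  gcongr

/-! ### Paths of embedded polygons give ambient isotopies -/

/-- Some ambient isotopy carries the closed polygons with vertex positions `P` edge by edge to those
with vertex positions `Q`, affinely on each edge. -/
def CarriedTo (next : Equiv.Perm V) (P Q : V → Space) : Prop :=
  ∃ Φ, IsAmbientIsotopyEnd Φ ∧ ∀ a, ∀ s ∈ Set.Icc (0 : ℝ) 1,
    Φ (edgePoint next P a s) = edgePoint next Q a s

theorem CarriedTo.refl (P : V → Space) : CarriedTo next P P :=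
  ⟨id, .id, fun _ _ _ => rfl⟩

theorem CarriedTo.trans {P Q R : V → Space} (h : CarriedTo next P Q) (h' : CarriedTo next Q R) :
    CarriedTo next P R := by
  obtain ⟨Φ, hΦ, e⟩ := h
  obtain ⟨Ψ, hΨ, e'⟩ := h'
  refine ⟨Ψ ∘ Φ, hΨ.comp hΦ, fun a s hs => ?_⟩
  rw [Function.comp_apply, e a s hs, e' a s hs]

/-- If the displacement from `P` to `Q` is Lipschitz on the polygon, with a constant less than `1`,
then its Lipschitz extension to space gives an ambient isotopy. -/
theorem carriedTo_of_displacement {P Q : V → Space} {κ : NNReal} (hκ : κ < 1)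
    (h : ∀ a b, ∀ s ∈ Set.Icc (0 : ℝ) 1, ∀ s' ∈ Set.Icc (0 : ℝ) 1,
      ‖edgePoint next (Q - P) a s - edgePoint next (Q - P) b s'‖ ≤
        κ * ‖edgePoint next P a s - edgePoint next P b s'‖) : CarriedTo next P Q := by
  let X := {x : Space | ∃ a, ∃ s ∈ Set.Icc (0 : ℝ) 1, edgePoint next P a s = x}
  have hX : ∀ x ∈ X, ∃ y, ∃ a, ∃ s ∈ Set.Icc (0 : ℝ) 1,
      edgePoint next P a s = x ∧ edgePoint next (Q - P) a s = y := by
    rintro x ⟨a, s, hs, e⟩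
    exact ⟨_, a, s, hs, e, rfl⟩
  choose! u hu using hX
  have hL : LipschitzOnWith κ u X := by
    refine LipschitzOnWith.of_dist_le_mul fun x hx y hy => ?_
    obtain ⟨a, s, hs, e, e'⟩ := hu x hx
    obtain ⟨b, s', hs', f, f'⟩ := hu y hy
    rw [dist_eq_norm, dist_eq_norm, ← e', ← f', ← e, ← f]
    exact h a b s hs s' hs'
  obtain ⟨g, hg, hgu⟩ := hL.extend_space
  refine ⟨_, isAmbientIsotopyEnd_add_of_lipschitz hκ hg, fun a s hs => ?_⟩
  have hx : edgePoint next P a s ∈ X := ⟨a, s, hs, rfl⟩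
  obtain ⟨b, s', hs', e, e'⟩ := hu _ hx
  have h0 : edgePoint next (Q - P) b s' = edgePoint next (Q - P) a s := by
    have := h b a s' hs' s hs
    rw [e, sub_self, norm_zero, mul_zero] at this
    exact sub_eq_zero.1 (norm_le_zero_iff.1 this)
  rw [← hgu hx, ← e', h0, edgePoint_sub]
  abel

/-- Isotopy extension for polygons: if the vertices of closed polygons move continuously and the
polygons stay embedded, then the motion is the restriction of an ambient isotopy. -/
theorem carriedTo_of_path [Finite V] (hF : ∀ v, Continuous fun t => F t v)
    (he : ∀ t ∈ Set.Icc (0 : ℝ) 1, IsEmbedded next (F t)) : CarriedTo next (F 0) (F 1) := by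
  obtain ⟨C, hC, hb⟩ := exists_displacement_bound hF he
  cases nonempty_fintype V
  -- the step size at which the displacements have a Lipschitz constant of at most `1 / 2`
  have hF' : Continuous F := continuous_pi hF
  obtain ⟨δ, hδ, hd⟩ := Metric.uniformContinuousOn_iff_le.1
    (isCompact_Icc.uniformContinuousOn_of_continuous (s := Set.Icc (0 : ℝ) 1) hF'.continuousOn)
    (1 / (2 * (C + 1))) (by positivity)
  obtain ⟨N, hN⟩ := exists_nat_one_div_lt hδ
  have hN0 : (0 : ℝ) < N + 1 := by positivity
  have hmem : ∀ j : ℕ, j ≤ N + 1 → (j : ℝ) / (N + 1) ∈ Set.Icc (0 : ℝ) 1 := by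
    intro j hj
    refine ⟨by positivity, ?_⟩
    rw [div_le_one hN0]
    exact_mod_cast hj
  have step : ∀ j : ℕ, j ≤ N + 1 → CarriedTo next (F 0) (F ((j : ℝ) / (N + 1))) := by
    intro j
    induction j with
    | zero => intro _; simpa using CarriedTo.refl (F 0)
    | succ j ih =>
      intro hj
      refine (ih (by omega)).trans ?_
      have h1 := hmem j (by omega)
      have h2 := hmem (j + 1) hj
      have hQ : ∀ v, ‖(F (((j + 1 : ℕ) : ℝ) / (N + 1)) - F ((j : ℝ) / (N + 1))) v‖ ≤
          1 / (2 * (C + 1)) := by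
        intro v
        rw [Pi.sub_apply, ← dist_eq_norm]
        refine (dist_le_pi_dist _ _ v).trans (hd _ h2 _ h1 ?_)
        rw [Real.dist_eq, Nat.cast_add, Nat.cast_one, add_div, add_sub_cancel_left,
          abs_of_nonneg (by positivity)]
        exact hN.le
      refine carriedTo_of_displacement (κ := 1 / 2)
        (by rw [← NNReal.coe_lt_coe]; norm_num) fun a b s hs s' hs' => ?_
      refine (hb _ h1 _ _ hQ a b s hs s' hs').trans
        (mul_le_mul_of_nonneg_right ?_ (norm_nonneg _))
      rw [mul_one_div, div_le_iff₀ (by positivity)]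
      norm_num
      linarith
  have := step (N + 1) le_rfl
  rwa [Nat.cast_add, Nat.cast_one, div_self hN0.ne'] at this

/-- The path and its reverse. The relation `CarriedTo` is symmetric, but reversing the path is simpler
than inverting the ambient isotopy. -/
theorem carriedTo_symm_of_path [Finite V] (hF : ∀ v, Continuous fun t => F t v)
    (he : ∀ t ∈ Set.Icc (0 : ℝ) 1, IsEmbedded next (F t)) :
    CarriedTo next (F 0) (F 1) ∧ CarriedTo next (F 1) (F 0) := by
  refine ⟨carriedTo_of_path hF he, ?_⟩
  have := carriedTo_of_path (next := next) (F := fun t => F (1 - t))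
    (fun v => (hF v).comp (continuous_const.sub continuous_id))
    (fun t ht => he _ ⟨by linarith [ht.2], by linarith [ht.1]⟩)
  simpa using this

/-- An ambient isotopy that carries polygons edge by edge is an isotopy of oriented links. -/
theorem CarriedTo.isotopic {P Q : V → Space} (h : CarriedTo next P Q) (hV : Finite V)
    (hP : IsEmbedded next P) (hQ : IsEmbedded next Q) :
    OrientedLink.Isotopic ⟨V, hV, next, P, hP⟩ ⟨V, hV, next, Q, hQ⟩ := by
  obtain ⟨Φ, ⟨H, hH, hh, h0, rfl⟩, e⟩ := h
  refine ⟨H, hH, hh, h0, ?_, fun a => ⟨a, OrderIso.refl ℝ, fun t => ?_⟩⟩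
  · simp only [OrientedLink.support, Set.image_iUnion, segment_eq_image_lineMap, Set.image_image]
    exact Set.iUnion_congr fun a => Set.image_congr fun s hs => e a s hs
  · exact e _ _ ⟨Int.fract_nonneg t, (Int.fract_lt_one t).le⟩

end Polygons

/-! ### Isotopy of links is transitive -/

theorem OrientedLink.Isotopic.trans {L L' L'' : OrientedLink} (h : L.Isotopic L')
    (h' : L'.Isotopic L'') : L.Isotopic L'' := by
  obtain ⟨H, hH, hh, h0, hs, ht⟩ := h
  obtain ⟨K, hK, hk, k0, ks, kt⟩ := h'
  refine ⟨fun t => K t ∘ H t, hK.comp (continuous_fst.prodMk hH), fun t => (hk t).comp (hh t),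
    by simp [h0, k0], by rw [Set.image_comp, hs, ks], fun a => ?_⟩
  obtain ⟨b, φ, hφ⟩ := ht a
  obtain ⟨c, ψ, hψ⟩ := kt b
  exact ⟨c, φ.trans ψ, fun t => by
    rw [OrderIso.trans_apply, ← hψ, ← hφ]
    rfl⟩

/-! ### Arcs of closed braids -/

theorem IsEmbedded.map {V : Type} {next : Equiv.Perm V} {P : V → Space} (h : IsEmbedded next P)
    {A : Space → Space} (hA : Function.Injective A)
    (hl : ∀ (p q : Space) (s : ℝ), A (AffineMap.lineMap p q s) = AffineMap.lineMap (A p) (A q) s) :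
    IsEmbedded next fun v => A (P v) := by
  intro a b s hs t ht e
  refine h a b s hs t ht (hA ?_)
  simpa only [edgePoint, hl] using e

/-- Vertex positions of closed polygons composed of the arcs
`(i, 0, 0) → (i, 0, h i) → (X i, e i, Z i) → (σ i, e i, -W i) → (σ i, 0, 0)`. -/
def arcPos {n : ℕ} (σ : Equiv.Perm (Fin n)) (h X e Z W : Fin n → ℝ) : Fin n × Fin 4 → Space
  | (i, 0) => ((i : ℕ), 0, 0)
  | (i, 1) => ((i : ℕ), 0, h i)
  | (i, 2) => (X i, e i, Z i)
  | (i, 3) => ((σ i : ℕ), e i, -W i)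

section Arcs

variable {n : ℕ} {σ : Equiv.Perm (Fin n)} {h X e Z W : Fin n → ℝ}

/-- The first edges of the arcs are vertical in the plane `y = 0`, the last ones lie over the
lines `x = σ i`. This leaves six kinds of pairs of edges to be compared. -/
theorem isEmbedded_arcPos (hh : ∀ i, 0 < h i) (hZ : ∀ i, 0 ≤ Z i) (hW : ∀ i, 0 ≤ W i)
    (heW : ∀ i, e i ≠ 0 ∨ 0 < W i)
    (h01 : ∀ i j : Fin n, ∀ s t : ℝ, 0 ≤ s → s < 1 → 0 ≤ t → t < 1 →
      ((i : ℕ) : ℝ) = (j : ℕ) + t * (X j - (j : ℕ)) → t * e j = 0 →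
      s * h i = h j + t * (Z j - h j) → False)
    (h02 : ∀ i j : Fin n, ∀ s t : ℝ, 0 ≤ s → s < 1 → 0 ≤ t → t < 1 →
      ((i : ℕ) : ℝ) = X j + t * ((σ j : ℕ) - X j) → e j = 0 →
      s * h i = Z j + t * (-W j - Z j) → False)
    (h11 : ∀ i j : Fin n, ∀ s t : ℝ, 0 ≤ s → s < 1 → 0 ≤ t → t < 1 →
      (i : ℕ) + s * (X i - (i : ℕ)) = (j : ℕ) + t * (X j - (j : ℕ)) → s * e i = t * e j →
      h i + s * (Z i - h i) = h j + t * (Z j - h j) → i = j ∧ s = t)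
    (h12 : ∀ i j : Fin n, ∀ s t : ℝ, 0 ≤ s → s < 1 → 0 ≤ t → t < 1 →
      (i : ℕ) + s * (X i - (i : ℕ)) = X j + t * ((σ j : ℕ) - X j) → s * e i = e j →
      h i + s * (Z i - h i) = Z j + t * (-W j - Z j) → False)
    (h22 : ∀ i j : Fin n, ∀ s t : ℝ, 0 ≤ s → s < 1 → 0 ≤ t → t < 1 →
      X i + s * ((σ i : ℕ) - X i) = X j + t * ((σ j : ℕ) - X j) → e i = e j →
      Z i + s * (-W i - Z i) = Z j + t * (-W j - Z j) → i = j ∧ s = t)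
    (h23 : ∀ i j : Fin n, ∀ s t : ℝ, 0 ≤ s → s < 1 → 0 ≤ t → t < 1 →
      X i + s * ((σ i : ℕ) - X i) = (σ j : ℕ) → e i = (1 - t) * e j →
      Z i + s * (-W i - Z i) = -((1 - t) * W j) → False) :
    IsEmbedded (arcNext σ) (arcPos σ h X e Z W) := by
  -- the comparisons that do not depend on the particular arcs
  have h00 : ∀ i j : Fin n, ∀ s t : ℝ, ((i : ℕ) : ℝ) = (j : ℕ) → s * h i = t * h j →
      i = j ∧ s = t := by
    intro i j s t hx hz
    obtain rfl := fin_eq_of_cast hx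
    exact ⟨rfl, mul_right_cancel₀ (hh i).ne' hz⟩
  have h03 : ∀ i j : Fin n, ∀ s t : ℝ, 0 ≤ s → t < 1 → (1 - t) * e j = 0 →
      s * h i = -((1 - t) * W j) → False := by
    intro i j s t hs ht hy hz
    have h1 : 0 < 1 - t := by linarith
    rcases heW j with h2 | h2
    · exact mul_ne_zero h1.ne' h2 hy
    · have := mul_pos h1 h2
      have := mul_nonneg hs (hh i).le
      linarith
  have h13 : ∀ i j : Fin n, ∀ s t : ℝ, 0 ≤ s → s < 1 → t < 1 →
      h i + s * (Z i - h i) = -((1 - t) * W j) → False := by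
    intro i j s t hs hs1 ht hz
    have h1 : 0 < (1 - s) * h i := mul_pos (by linarith) (hh i)
    have h2 := mul_nonneg hs (hZ i)
    have h3 : 0 ≤ (1 - t) * W j := mul_nonneg (by linarith) (hW j)
    linarith
  have h33 : ∀ i j : Fin n, ∀ s t : ℝ, ((σ i : ℕ) : ℝ) = (σ j : ℕ) → (1 - s) * e i = (1 - t) * e j →
      (1 - s) * W i = (1 - t) * W j → i = j ∧ s = t := by
    intro i j s t hx hy hz
    obtain rfl := σ.injective (fin_eq_of_cast hx)
    refine ⟨rfl, ?_⟩
    rcases heW i with h2 | h2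
    · linarith [mul_right_cancel₀ h2 hy]
    · linarith [mul_right_cancel₀ h2.ne' hz]
  rintro ⟨i, j⟩ ⟨i', j'⟩ s ⟨hs0, hs1⟩ t ⟨ht0, ht1⟩ he
  rw [edgePoint, edgePoint, lineMap_coords, lineMap_coords, Prod.mk.injEq, Prod.mk.injEq] at he
  obtain ⟨hx, hy, hz⟩ := he
  fin_cases j <;> fin_cases j' <;> simp only [arcNext, arcPos] at hx hy hz
  · obtain ⟨rfl, rfl⟩ := h00 i i' s t (by simpa using hx) (by simpa using hz)
    exact ⟨rfl, rfl⟩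
  · exact (h01 i i' s t hs0 hs1 ht0 ht1
      (by simpa using hx) (by simpa using hy.symm) (by simpa using hz)).elim
  · exact (h02 i i' s t hs0 hs1 ht0 ht1
      (by simpa using hx) (by simpa using hy.symm) (by simpa using hz)).elim
  · exact (h03 i i' s t hs0 ht1 (by simp at hy; linarith) (by simp at hz; linarith)).elim
  · exact (h01 i' i t s ht0 ht1 hs0 hs1
      (by simpa using hx.symm) (by simpa using hy) (by simpa using hz.symm)).elim
  · obtain ⟨rfl, rfl⟩ := h11 i i' s t hs0 hs1 ht0 ht1
      (by simpa using hx) (by simpa using hy) (by simpa using hz)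
    exact ⟨rfl, rfl⟩
  · exact (h12 i i' s t hs0 hs1 ht0 ht1
      (by simpa using hx) (by simpa using hy) (by simpa using hz)).elim
  · exact (h13 i i' s t hs0 hs1 ht1 (by simp at hz; linarith)).elim
  · exact (h02 i' i t s ht0 ht1 hs0 hs1
      (by simpa using hx.symm) (by simpa using hy) (by simpa using hz.symm)).elim
  · exact (h12 i' i t s ht0 ht1 hs0 hs1
      (by simpa using hx.symm) (by simpa using hy.symm) (by simpa using hz.symm)).elim
  · obtain ⟨rfl, rfl⟩ := h22 i i' s t hs0 hs1 ht0 ht1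
      (by simpa using hx) (by simpa using hy) (by simpa using hz)
    exact ⟨rfl, rfl⟩
  · exact (h23 i i' s t hs0 hs1 ht0 ht1
      (by simpa using hx) (by simp at hy; linarith) (by simp at hz; linarith)).elim
  · exact (h03 i' i t s ht0 hs1 (by simp at hy; linarith) (by simp at hz; linarith)).elim
  · exact (h13 i' i t s ht0 ht1 hs1 (by simp at hz; linarith)).elim
  · exact (h23 i' i t s ht0 ht1 hs0 hs1
      (by simpa using hx.symm) (by simp at hy; linarith) (by simp at hz; linarith)).elim
  · obtain ⟨rfl, rfl⟩ := h33 i i' s t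
      (by simpa using hx) (by simp at hy; linarith) (by simp at hz; linarith)
    exact ⟨rfl, rfl⟩

/-- The criterion for arcs whose second edge is horizontal and whose third edge is vertical: it
only remains to compare second edges of the same height, and second edges with third edges that
are at least as high. -/
theorem isEmbedded_arcPos_upright (hh : ∀ i, 0 < h i) (he : ∀ i, e i ≠ 0)
    (h11 : ∀ i j : Fin n, ∀ s t : ℝ,
      (i : ℕ) + s * ((σ i : ℕ) - (i : ℕ) : ℝ) = (j : ℕ) + t * ((σ j : ℕ) - (j : ℕ) : ℝ) →
      s * e i = t * e j → h i = h j → i = j)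
    (h12 : ∀ i j : Fin n, ∀ s : ℝ, 0 ≤ s → s < 1 →
      (i : ℕ) + s * ((σ i : ℕ) - (i : ℕ) : ℝ) = (σ j : ℕ) → s * e i = e j → h i ≤ h j → False) :
    IsEmbedded (arcNext σ) (arcPos σ h (fun i => ((σ i : ℕ) : ℝ)) e h 0) := by
  refine isEmbedded_arcPos hh (fun i => (hh i).le) (fun _ => le_rfl) (fun i => Or.inl (he i))
    ?_ ?_ ?_ ?_ ?_ ?_
  · intro i j s t hs0 hs1 ht0 ht1 hx hy hz
    have h0 : t = 0 := (mul_eq_zero.1 hy).resolve_right (he j)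
    subst h0
    obtain rfl : i = j := fin_eq_of_cast (by simpa using hx)
    nlinarith [hh i]
  · intro i j s t _ _ _ _ _ hy _
    exact he j hy
  · intro i j s t hs0 hs1 ht0 ht1 hx hy hz
    obtain rfl := h11 i j s t hx hy (by simpa using hz)
    exact ⟨rfl, mul_right_cancel₀ (he i) hy⟩
  · intro i j s t hs0 hs1 ht0 ht1 hx hy hz
    refine h12 i j s hs0 hs1 (by simpa using hx) hy ?_
    have := mul_nonneg ht0 (hh j).le
    simp at hz
    linarith
  · intro i j s t hs0 hs1 ht0 ht1 hx hy hz
    obtain rfl : i = j := σ.injective (fin_eq_of_cast (by simpa using hx))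
    refine ⟨rfl, mul_right_cancel₀ (hh i).ne' ?_⟩
    rw [Pi.zero_apply] at hz
    linarith
  · intro i j s t hs0 hs1 ht0 ht1 hx hy hz
    have : 0 < (1 - s) * h i := mul_pos (by linarith) (hh i)
    simp at hz
    linarith

/-- Arcs whose heights and positions vary continuously. -/
theorem continuous_arcPos {h X e Z W : ℝ → Fin n → ℝ} (hh : ∀ i, Continuous fun t => h t i)
    (hX : ∀ i, Continuous fun t => X t i) (he : ∀ i, Continuous fun t => e t i)
    (hZ : ∀ i, Continuous fun t => Z t i) (hW : ∀ i, Continuous fun t => W t i)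
    (v : Fin n × Fin 4) :
    Continuous fun t => arcPos σ (h t) (X t) (e t) (Z t) (W t) v := by
  obtain ⟨i, j⟩ := v
  have := hh i
  have := hX i
  have := he i
  have := hZ i
  have := hW i
  fin_cases j <;> simp only [arcPos] <;> fun_prop

end Arcs

/-! ### Shuffles without fixed points -/

/-- The properties of a fixed-point-free shuffle `σ` that the isotopies depend on. The elements with
`i < σ i` come first, and `σ` is increasing on them and on the remaining ones. -/
structure IsLorenzPerm {n : ℕ} (σ : Equiv.Perm (Fin n)) : Prop where
  ne : ∀ i, i < σ i ∨ σ i < i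
  mono_up : ∀ {i j}, i < σ i → j < σ j → i < j → σ i < σ j
  mono_down : ∀ {i j}, σ i < i → σ j < j → i < j → σ i < σ j
  up_lt_down : ∀ {i j}, i < σ i → σ j < j → i < j

theorem IsShuffleAt.le_apply {n : ℕ} {σ : Equiv.Perm (Fin n)} {k : ℕ} (h : IsShuffleAt σ k) :
    ∀ m (hm : m < n), m < k → m ≤ (σ ⟨m, hm⟩ : ℕ) := by
  intro m
  induction m with
  | zero => intros; omega
  | succ m ih =>
    intro hm hk
    have h1 := ih (by omega) (by omega)
    have h2 := h.2.1 ⟨m, by omega⟩ ⟨m + 1, hm⟩ (by simp) hk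
    rw [Fin.lt_def] at h2
    omega

theorem IsShuffleAt.apply_le {n : ℕ} {σ : Equiv.Perm (Fin n)} {k : ℕ} (h : IsShuffleAt σ k) :
    ∀ m (hm : m < n), k ≤ n - 1 - m → (σ ⟨n - 1 - m, by omega⟩ : ℕ) ≤ n - 1 - m := by
  intro m
  induction m with
  | zero => intros; omega
  | succ m ih =>
    intro hm hk
    have h1 := ih (by omega) (by omega)
    have h2 := h.2.2 ⟨n - 1 - (m + 1), by omega⟩ ⟨n - 1 - m, by omega⟩
      (by rw [Fin.lt_def]; dsimp only; omega) hk
    rw [Fin.lt_def] at h2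
    omega

theorem IsShuffleAt.lt_apply {n : ℕ} {σ : Equiv.Perm (Fin n)} {k : ℕ} (h : IsShuffleAt σ k)
    (hne : ∀ i, σ i ≠ i) {i : Fin n} (hi : (i : ℕ) < k) : i < σ i :=
  lt_of_le_of_ne (h.le_apply i i.2 hi) (hne i).symm

theorem IsShuffleAt.apply_lt {n : ℕ} {σ : Equiv.Perm (Fin n)} {k : ℕ} (h : IsShuffleAt σ k)
    (hne : ∀ i, σ i ≠ i) {i : Fin n} (hi : k ≤ (i : ℕ)) : σ i < i := by
  refine lt_of_le_of_ne ?_ (hne i)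
  have e : n - 1 - (n - 1 - (i : ℕ)) = i := by omega
  have h1 := h.apply_le (n - 1 - i) (by omega) (by omega)
  simp only [e] at h1
  exact h1

theorem LorenzShuffle.isLorenzPerm (σ : LorenzShuffle) : IsLorenzPerm σ.perm := by
  obtain ⟨k, hk⟩ := σ.shuffle
  have up : ∀ {i}, i < σ.perm i → (i : ℕ) < k := fun {i} hi => by
    by_contra h
    exact lt_asymm hi (hk.apply_lt σ.perm_ne (not_lt.1 h))
  have down : ∀ {i}, σ.perm i < i → k ≤ (i : ℕ) := fun {i} hi => by
    by_contra h
    exact lt_asymm hi (hk.lt_apply σ.perm_ne (not_le.1 h))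
  exact {
    ne := fun i => lt_or_gt_of_ne (σ.perm_ne i).symm
    mono_up := fun _ hj hij => hk.2.1 _ _ hij (up hj)
    mono_down := fun hi _ hij => hk.2.2 _ _ hij (down hi)
    up_lt_down := fun hi hj => Fin.lt_def.2 ((up hi).trans_le (down hj)) }

/-! ### The isotopy from the diagonal link to the Lorenz link -/

section Stages

variable {n : ℕ} {σ : Equiv.Perm (Fin n)}

/-- Passing to real coordinates: the order of two indices. -/
theorem Fin.cast_add_one_le {i j : Fin n} (h : i < j) : ((i : ℕ) : ℝ) + 1 ≤ (j : ℕ) := by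
  exact_mod_cast Fin.lt_def.1 h

theorem Fin.cast_add_one_le_size (i : Fin n) : ((i : ℕ) : ℝ) + 1 ≤ n := by
  exact_mod_cast i.2

/-- The heights `n - i`, by which strands further to the left pass over strands further to the
right. -/
def strandHeight (n : ℕ) (i : Fin n) : ℝ := n - (i : ℕ)

theorem strandHeight_pos (i : Fin n) : 0 < strandHeight n i := by
  unfold strandHeight
  linarith [Fin.cast_add_one_le_size i]

theorem strandHeight_inj {i j : Fin n} (h : strandHeight n i = strandHeight n j) : i = j :=
  fin_eq_of_cast (by unfold strandHeight at h; linarith)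

/-- The stages at which the upper hooks of the diagonal link are raised to different heights and
widened to different widths. -/
noncomputable def raisePos (σ : Equiv.Perm (Fin n)) (t : ℝ) : Fin n × Fin 4 → Space :=
  arcPos σ (fun i => 1 - t + t * strandHeight n i) (fun i => ((σ i : ℕ) : ℝ))
    (fun i => (1 - t) * ((σ i : ℕ) - (i : ℕ) : ℝ) + t * (if i < σ i then strandHeight n i else -1))
    (fun i => 1 - t + t * strandHeight n i) 0

theorem isEmbedded_raisePos (hσ : IsLorenzPerm σ) {t : ℝ} (ht : t ∈ Set.Icc (0 : ℝ) 1) :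
    IsEmbedded (arcNext σ) (raisePos σ t) := by
  obtain ⟨ht0, ht1⟩ := ht
  -- the sign of the `y`-coordinate tells the two kinds of arcs apart
  have hu : ∀ i, i < σ i → 0 < (1 - t) * ((σ i : ℕ) - (i : ℕ) : ℝ) +
      t * (if i < σ i then strandHeight n i else -1) := by
    intro i hi
    rw [if_pos hi]
    have h1 := Fin.cast_add_one_le hi
    have h2 := Fin.cast_add_one_le_size i
    unfold strandHeight
    nlinarith
  have hd : ∀ i, σ i < i → (1 - t) * ((σ i : ℕ) - (i : ℕ) : ℝ) +
      t * (if i < σ i then strandHeight n i else -1) < 0 := by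
    intro i hi
    rw [if_neg hi.asymm]
    have h1 := Fin.cast_add_one_le hi
    nlinarith
  refine isEmbedded_arcPos_upright (fun i => ?_) (fun i => ?_) ?_ ?_
  · unfold strandHeight
    nlinarith [Fin.cast_add_one_le_size i]
  · exact (hσ.ne i).elim (fun h => (hu i h).ne') (fun h => (hd i h).ne)
  · intro i j s s' hx hy hz
    rcases eq_or_ne t 0 with rfl | h0
    · apply fin_eq_of_cast
      simp at hy
      linarith
    · exact strandHeight_inj (mul_left_cancel₀ h0 (by linarith))
  · intro i j s hs0 hs1 hx hy hz
    rcases hσ.ne i with hi | hi <;> rcases hσ.ne j with hj | hj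
    · rw [if_pos hi, if_pos hj] at hy
      have hij : t * ((j : ℕ) - (i : ℕ) : ℝ) ≤ 0 := by
        unfold strandHeight at hz
        linarith
      have e1 : s * ((σ i : ℕ) - (i : ℕ) : ℝ) = (σ j : ℕ) - (i : ℕ) := by linarith
      have e2 : t * (s * strandHeight n i) =
          (1 - t) * ((i : ℕ) - (j : ℕ) : ℝ) + t * strandHeight n j := by
        linear_combination hy - (1 - t) * e1
      have h3 : s * strandHeight n i < strandHeight n i := by
        nlinarith [strandHeight_pos i]
      unfold strandHeight at *
      rcases ht0.eq_or_lt with rfl | h0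
      · obtain rfl : i = j := fin_eq_of_cast (by linarith)
        have := Fin.cast_add_one_le hi
        nlinarith
      · have h4 := mul_lt_mul_of_pos_left h3 h0
        have h5 : ((j : ℕ) : ℝ) ≤ (i : ℕ) := by nlinarith
        nlinarith
    · have h1 := hu i hi
      have h2 := hd j hj
      have h3 := mul_nonneg hs0 h1.le
      linarith
    · have h1 := hd i hi
      have h2 := hu j hj
      have h3 := mul_nonneg hs0 (neg_pos.2 h1).le
      linarith
    · rw [if_neg hi.asymm, if_neg hj.asymm] at hy
      have c1 := Fin.cast_add_one_le hi
      -- the second edge of the arc `i` stays to the right of `σ i`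
      have c2 : ((σ i : ℕ) : ℝ) < (σ j : ℕ) := by nlinarith
      have c3 : i < j := by
        by_contra hc
        rcases (not_lt.1 hc).eq_or_lt with rfl | hc
        · exact lt_irrefl _ c2
        · linarith [Fin.cast_add_one_le (hσ.mono_down hj hi hc)]
      have c4 := Fin.cast_add_one_le c3
      unfold strandHeight at hz
      rcases ht0.eq_or_lt with rfl | h0
      · nlinarith
      · nlinarith

/-- The stages at which the strands that go to the right are pulled over the right end of the
diagram: the arc `i` is widened to reach the line `x = 2 n - i` beyond all other arcs, at `t = 1`,
and is moved from `y > 0` to `y < 0` by letting `ε` vary from `1` to `-1`. At `t = 1`, the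
projections of these arcs to the `xz`-plane are disjoint from each other and from those of the
other arcs. -/
noncomputable def sweepPos (σ : Equiv.Perm (Fin n)) (t ε : ℝ) : Fin n × Fin 4 → Space :=
  arcPos σ (strandHeight n)
    (fun i => if i < σ i then (1 - t) * (σ i : ℕ) + t * (2 * n - (i : ℕ)) else (σ i : ℕ))
    (fun i => if i < σ i then ε * strandHeight n i else -1)
    (fun i => if i < σ i then (1 - t) * strandHeight n i else strandHeight n i)
    (fun i => if i < σ i then t * ((2 * n - (i : ℕ) - (σ i : ℕ)) / 2) else 0)

theorem isEmbedded_sweepPos (hσ : IsLorenzPerm σ) {t ε : ℝ} (ht : t ∈ Set.Icc (0 : ℝ) 1)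
    (hε : |ε| = 1 ∨ t = 1) : IsEmbedded (arcNext σ) (sweepPos σ t ε) := by
  obtain ⟨ht0, ht1⟩ := ht
  have ht' : 0 ≤ 1 - t := by linarith
  have hε0 : |ε| = 1 → ε ≠ 0 := by
    rintro h rfl
    simp at h
  have size := Fin.cast_add_one_le_size (n := n)
  have pos := strandHeight_pos (n := n)
  refine isEmbedded_arcPos strandHeight_pos ?_ ?_ ?_ ?_ ?_ ?_ ?_ ?_ ?_
  · intro i
    rcases hσ.ne i with hi | hi
    · simpa only [if_pos hi] using mul_nonneg ht' (pos i).le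
    · simpa only [if_neg hi.asymm] using (pos i).le
  · intro i
    rcases hσ.ne i with hi | hi
    · simp only [if_pos hi]
      exact mul_nonneg ht0 (by linarith [size i, size (σ i)])
    · simp only [if_neg hi.asymm]
      exact le_rfl
  · intro i
    rcases hσ.ne i with hi | hi
    · simp only [if_pos hi]
      rcases hε with hε | rfl
      · exact Or.inl (mul_ne_zero (hε0 hε) (pos i).ne')
      · exact Or.inr (by linarith [size i, size (σ i)])
    · simp only [if_neg hi.asymm]
      exact Or.inl (by norm_num)
  · intro i j s s' hs0 hs1 ht0' ht1' hx hy hz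
    have h0 : s' ≠ 0 := by
      rintro rfl
      obtain rfl : i = j := fin_eq_of_cast (by linarith)
      nlinarith [pos i]
    have h1 := (mul_eq_zero.1 hy).resolve_left h0
    rcases hσ.ne j with hj | hj
    · rw [if_pos hj] at h1 hx hz
      rcases hε with hε | rfl
      · exact mul_ne_zero (hε0 hε) (pos j).ne' h1
      · have h2 := mul_nonneg ht0' (pos j).le
        have h3 : s * strandHeight n i < strandHeight n i := by nlinarith [pos i]
        unfold strandHeight at *
        linarith
    · rw [if_neg hj.asymm] at h1
      linarith
  · intro i j s s' hs0 hs1 ht0' ht1' hx h1 hz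
    rcases hσ.ne j with hj | hj
    · rw [if_pos hj] at h1 hx hz
      rw [if_pos hj] at hz
      rcases hε with hε | rfl
      · exact mul_ne_zero (hε0 hε) (pos j).ne' h1
      · have hD : 0 < (2 * (n : ℝ) - (j : ℕ) - (σ j : ℕ)) / 2 := by linarith [size j, size (σ j)]
        have h2 := mul_nonneg hs0 (pos i).le
        have h3 := mul_nonneg ht0' hD.le
        linarith [size i, size j]
    · rw [if_neg hj.asymm] at h1
      linarith
  · intro i j s s' hs0 hs1 ht0' ht1' hx hy hz
    have up_down : ∀ i j : Fin n, ∀ s s' : ℝ, 0 ≤ s → 0 ≤ s' → i < σ i → σ j < j →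
        (i : ℕ) + s * ((1 - t) * (σ i : ℕ) + t * (2 * n - (i : ℕ)) - (i : ℕ) : ℝ) =
          (j : ℕ) + s' * ((σ j : ℕ) - (j : ℕ) : ℝ) →
        strandHeight n i + s * ((1 - t) * strandHeight n i - strandHeight n i) =
          strandHeight n j → False := by
      intro i j s s' hs hs' hi hj hx hz
      have c1 := Fin.cast_add_one_le hi
      have c2 := Fin.cast_add_one_le hj
      have c3 := Fin.cast_add_one_le (hσ.up_lt_down hi hj)
      have c4 : 0 ≤ s * (1 - t) * ((σ i : ℕ) - (i : ℕ) : ℝ) :=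
        mul_nonneg (mul_nonneg hs ht') (by linarith)
      have c5 : 0 ≤ s' * ((j : ℕ) - (σ j : ℕ) : ℝ) := mul_nonneg hs' (by linarith)
      unfold strandHeight at hz
      nlinarith
    rcases hσ.ne i with hi | hi <;> rcases hσ.ne j with hj | hj
    · simp only [if_pos hi, if_pos hj] at hx hy hz
      rcases hε with hε | rfl
      · have e : s * strandHeight n i = s' * strandHeight n j :=
          mul_left_cancel₀ (hε0 hε) (by linear_combination hy)
        obtain rfl : i = j := strandHeight_inj (by linear_combination hz + t * e)
        exact ⟨rfl, mul_right_cancel₀ (pos i).ne' e⟩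
      · obtain rfl : i = j := strandHeight_inj (by
          unfold strandHeight at *
          linear_combination 2 * hz + hx)
        exact ⟨rfl, mul_right_cancel₀ (pos i).ne' (by linear_combination -hz)⟩
    · simp only [if_pos hi, if_neg hj.asymm] at hx hz
      exact (up_down i j s s' hs0 ht0' hi hj hx (by linarith)).elim
    · simp only [if_neg hi.asymm, if_pos hj] at hx hz
      exact (up_down j i s' s ht0' hs0 hj hi hx.symm (by linarith)).elim
    · simp only [if_neg hi.asymm, if_neg hj.asymm] at hy hz
      exact ⟨strandHeight_inj (by linarith), by linarith⟩
  · intro i j s s' hs0 hs1 ht0' ht1' hx hy hz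
    have c0 := size i
    have d0 := size j
    have d1 := size (σ j)
    rcases hσ.ne i with hi | hi <;> rcases hσ.ne j with hj | hj
    · simp only [if_pos hi, if_pos hj] at hx hy hz
      have hD : 0 ≤ s' * (t * ((2 * (n : ℝ) - (j : ℕ) - (σ j : ℕ)) / 2)) :=
        mul_nonneg ht0' (mul_nonneg ht0 (by linarith))
      rcases hε with hε | rfl
      · have e : s * strandHeight n i = strandHeight n j :=
          mul_left_cancel₀ (hε0 hε) (by linear_combination hy)
        have h1 : 0 ≤ s' * ((1 - t) * strandHeight n j) :=
          mul_nonneg ht0' (mul_nonneg ht' (pos j).le)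
        have h2 : s * strandHeight n i < strandHeight n i := by nlinarith [pos i]
        have h3 : strandHeight n i + t * (s * strandHeight n i) * (-1) ≤
          (1 - t) * strandHeight n j := by linarith
        rw [e] at h3
        linarith
      · have h1 : 0 < (1 - s) * strandHeight n i := mul_pos (by linarith) (pos i)
        linarith
    · simp only [if_pos hi, if_neg hj.asymm] at hx hz
      have c1 := Fin.cast_add_one_le hi
      have c2 := Fin.cast_add_one_le hj
      have c3 := Fin.cast_add_one_le (hσ.up_lt_down hi hj)
      have c4 : 0 ≤ s * (1 - t) * ((σ i : ℕ) - (i : ℕ) : ℝ) :=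
        mul_nonneg (mul_nonneg hs0 ht') (by linarith)
      have c5 := mul_nonneg ht0' (pos j).le
      unfold strandHeight at *
      nlinarith
    · simp only [if_neg hi.asymm, if_pos hj] at hx hy hz
      rcases hε with hε | rfl
      · have c3 := Fin.cast_add_one_le (hσ.up_lt_down hj hi)
        have e : |ε * strandHeight n j| = strandHeight n j := by
          rw [abs_mul, hε, one_mul, abs_of_pos (pos j)]
        rw [← hy, mul_neg_one, abs_neg, abs_of_nonneg hs0] at e
        unfold strandHeight at e
        linarith
      · have hD : 0 ≤ s' * (1 * ((2 * (n : ℝ) - (j : ℕ) - (σ j : ℕ)) / 2)) :=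
          mul_nonneg ht0' (by linarith)
        linarith [pos i]
    · simp only [if_neg hi.asymm, if_neg hj.asymm] at hy
      linarith
  · intro i j s s' hs0 hs1 ht0' ht1' hx hy hz
    have up_down : ∀ i j : Fin n, ∀ s s' : ℝ, 0 ≤ s → s' < 1 → i < σ i → σ j < j →
        ε * strandHeight n i = -1 →
        (1 - t) * strandHeight n i + s * (-(t * ((2 * n - (i : ℕ) - (σ i : ℕ)) / 2)) -
          (1 - t) * strandHeight n i) = strandHeight n j + s' * (-0 - strandHeight n j) →
        False := by
      intro i j s s' hs hs' hi hj hy hz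
      rcases hε with hε | rfl
      · have c3 := Fin.cast_add_one_le (hσ.up_lt_down hi hj)
        have e : |ε * strandHeight n i| = strandHeight n i := by
          rw [abs_mul, hε, one_mul, abs_of_pos (pos i)]
        rw [hy, abs_neg, abs_one] at e
        unfold strandHeight at e
        linarith [size j]
      · have hD : 0 ≤ s * ((2 * (n : ℝ) - (i : ℕ) - (σ i : ℕ)) / 2) :=
          mul_nonneg hs (by linarith [size i, size (σ i)])
        have h1 : 0 < (1 - s') * strandHeight n j := mul_pos (by linarith) (pos j)
        linarith
    rcases hσ.ne i with hi | hi <;> rcases hσ.ne j with hj | hj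
    · simp only [if_pos hi, if_pos hj] at hx hy hz
      have hD : 0 < (2 * (n : ℝ) - (i : ℕ) - (σ i : ℕ)) / 2 := by
        linarith [size i, size (σ i)]
      have hij : i = j := by
        rcases hε with hε | rfl
        · exact strandHeight_inj (mul_left_cancel₀ (hε0 hε) hy)
        · exact strandHeight_inj (by unfold strandHeight at *; linear_combination hx - 2 * hz)
      subst hij
      refine ⟨rfl, ?_⟩
      have hpos : 0 < t * ((2 * (n : ℝ) - (i : ℕ) - (σ i : ℕ)) / 2) +
          (1 - t) * strandHeight n i := by
        have h1 := mul_nonneg ht' (pos i).le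
        rcases ht0.eq_or_lt with rfl | h0
        · linarith [pos i]
        · linarith [mul_pos h0 hD]
      exact mul_right_cancel₀ hpos.ne' (by linear_combination -hz)
    · simp only [if_pos hi, if_neg hj.asymm] at hy hz
      exact (up_down i j s s' hs0 ht1' hi hj hy hz).elim
    · simp only [if_neg hi.asymm, if_pos hj] at hy hz
      exact (up_down j i s' s ht0' hs1 hj hi hy.symm hz.symm).elim
    · simp only [if_neg hi.asymm, if_neg hj.asymm] at hx hz
      obtain rfl : i = j := σ.injective (fin_eq_of_cast (by linarith))
      exact ⟨rfl, mul_right_cancel₀ (pos i).ne' (by linear_combination -hz)⟩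
  · intro i j s s' hs0 hs1 ht0' ht1' hx hy hz
    have hs : 0 < 1 - s := by linarith
    have c0 := size i
    have c1 := size (σ i)
    have d0 := size j
    have d1 := size (σ j)
    rcases hσ.ne i with hi | hi <;> rcases hσ.ne j with hj | hj
    · simp only [if_pos hi, if_pos hj] at hx hy hz
      have hD : 0 < (2 * (n : ℝ) - (i : ℕ) - (σ i : ℕ)) / 2 := by linarith
      -- the third edge of the arc `i` stays to the right of `σ i`
      have hle : i ≤ j := by
        by_contra hc
        have h1 := Fin.cast_add_one_le (hσ.mono_up hj hi (not_le.1 hc))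
        have h2 := mul_nonneg hs.le (mul_nonneg ht0 hD.le)
        linarith
      have hge : j ≤ i := by
        by_contra hc
        have h1 := Fin.cast_add_one_le (not_le.1 hc)
        have h2 := Fin.cast_add_one_le (hσ.mono_up hi hj (not_le.1 hc))
        rcases hε with hε | rfl
        · have e : strandHeight n i = (1 - s') * strandHeight n j :=
            mul_left_cancel₀ (hε0 hε) (by linear_combination hy)
          have h3 := mul_nonneg ht0' (pos j).le
          unfold strandHeight at *
          linarith
        · have h3 := mul_nonneg ht0' (show 0 ≤ (2 * (n : ℝ) - (j : ℕ) - (σ j : ℕ)) / 2 by linarith)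
          linarith
      obtain rfl := le_antisymm hle hge
      have h1 : (1 - s) * (t * ((2 * (n : ℝ) - (i : ℕ) - (σ i : ℕ)) / 2)) = 0 := by
        linear_combination hx / 2
      have h2 : t = 0 := by
        rcases mul_eq_zero.1 h1 with h | h
        · exact absurd h hs.ne'
        · exact (mul_eq_zero.1 h).resolve_right hD.ne'
      subst h2
      have := mul_pos hs (pos i)
      linarith
    · simp only [if_pos hi, if_neg hj.asymm] at hx hy hz
      rcases hε with hε | rfl
      · have c3 := Fin.cast_add_one_le (hσ.up_lt_down hi hj)
        have e : |ε * strandHeight n i| = strandHeight n i := by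
          rw [abs_mul, hε, one_mul, abs_of_pos (pos i)]
        rw [hy, mul_neg_one, abs_neg, abs_of_pos (by linarith)] at e
        unfold strandHeight at e
        linarith
      · have hD : 0 < (2 * (n : ℝ) - (i : ℕ) - (σ i : ℕ)) / 2 := by linarith
        have h1 : s * ((2 * (n : ℝ) - (i : ℕ) - (σ i : ℕ)) / 2) = 0 := by linear_combination -hz
        rcases mul_eq_zero.1 h1 with h | h
        · subst h
          linarith
        · exact hD.ne' h
    · simp only [if_neg hi.asymm] at hx
      obtain rfl : i = j := σ.injective (fin_eq_of_cast (by linarith))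
      exact lt_asymm hi hj
    · simp only [if_neg hi.asymm, if_neg hj.asymm] at hz
      have := mul_pos hs (pos i)
      linarith

/-- The stages at which the strands of the closed braid are brought to the same width. -/
noncomputable def levelPos (σ : Equiv.Perm (Fin n)) (t : ℝ) : Fin n × Fin 4 → Space :=
  arcPos σ (strandHeight n) (fun i => ((σ i : ℕ) : ℝ))
    (fun i => if i < σ i then -((1 - t) * strandHeight n i + t) else -1) (strandHeight n) 0

theorem isEmbedded_levelPos (hσ : IsLorenzPerm σ) {t : ℝ} (ht : t ∈ Set.Icc (0 : ℝ) 1) :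
    IsEmbedded (arcNext σ) (levelPos σ t) := by
  obtain ⟨ht0, ht1⟩ := ht
  have hle : ∀ i : Fin n, 1 ≤ (1 - t) * strandHeight n i + t := by
    intro i
    have := Fin.cast_add_one_le_size i
    unfold strandHeight
    nlinarith
  refine isEmbedded_arcPos_upright strandHeight_pos (fun i => ?_)
    (fun i j s s' _ _ h => strandHeight_inj h) ?_
  · split_ifs
    · linarith [hle i]
    · norm_num
  · intro i j s hs0 hs1 hx hy hz
    rcases hσ.ne i with hi | hi <;> rcases hσ.ne j with hj | hj
    · rw [if_pos hi, if_pos hj] at hy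
      have h1 := mul_le_mul_of_nonneg_left hz (show 0 ≤ 1 - t by linarith)
      nlinarith [hle i]
    · have := Fin.cast_add_one_le (hσ.up_lt_down hi hj)
      unfold strandHeight at hz
      linarith
    · rw [if_neg hi.asymm, if_pos hj] at hy
      linarith [hle j]
    · rw [if_neg hi.asymm, if_neg hj.asymm] at hy
      linarith

end Stages

/-! ### The stages of the isotopy -/

/-- The linear maps that join the identity to the change of coordinates `(x, y) ↦ (y, y - x)`, under
which the diagonal becomes the line `y = 0`. -/
def diagonalToAxis (t : ℝ) (p : Space) : Space :=
  ((1 - t) * p.1 + t * p.2.1, p.2.1 - t * p.1, p.2.2)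

theorem injective_diagonalToAxis {t : ℝ} : Function.Injective (diagonalToAxis t) := by
  rintro ⟨x, y, z⟩ ⟨x', y', z'⟩ h
  simp only [diagonalToAxis, Prod.mk.injEq] at h ⊢
  obtain ⟨h1, h2, h3⟩ := h
  -- the determinant of the matrix is `1 - t + t ^ 2`
  have hd : 0 < 1 - t + t ^ 2 := by nlinarith [sq_nonneg (t - 1 / 2)]
  have hx : x = x' := mul_left_cancel₀ hd.ne' (by linear_combination h1 - t * h2)
  subst hx
  exact ⟨rfl, by linarith, h3⟩

namespace LorenzShuffle

variable (σ : LorenzShuffle)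

theorem isEmbedded_grid : IsEmbedded (arcNext σ.perm) σ.grid.pos :=
  σ.diagonalLink.embedded

theorem isEmbedded_permBraidPos : IsEmbedded (arcNext σ.perm) (permBraidPos σ.perm) :=
  σ.lorenzLink.embedded

theorem carriedTo_grid_raise :
    CarriedTo (arcNext σ.perm) σ.grid.pos (raisePos σ.perm 0) ∧
      CarriedTo (arcNext σ.perm) (raisePos σ.perm 0) σ.grid.pos := by
  have h := carriedTo_symm_of_path (next := arcNext σ.perm)
    (F := fun t (v : Fin σ.n × Fin 4) => diagonalToAxis t (σ.grid.pos v))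
    (fun v => by unfold diagonalToAxis; fun_prop)
    (fun t _ => σ.isEmbedded_grid.map injective_diagonalToAxis fun p q s => by
      rw [lineMap_coords, lineMap_coords]
      ext <;> simp only [diagonalToAxis] <;> ring)
  have h0 : (fun v : Fin σ.n × Fin 4 => diagonalToAxis 0 (σ.grid.pos v)) = σ.grid.pos := by
    funext v
    simp [diagonalToAxis]
  have h1 : (fun v : Fin σ.n × Fin 4 => diagonalToAxis 1 (σ.grid.pos v)) = raisePos σ.perm 0 := by
    have hs : ∀ i : Fin σ.n, σ.grid.start i = i := fun _ => rfl
    have hf : ∀ i : Fin σ.n, σ.grid.finish i = σ.perm i := fun _ => rfl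
    funext ⟨i, j⟩
    fin_cases j <;> simp [diagonalToAxis, raisePos, arcPos, GridDiagram.pos, hs, hf]
  rwa [h0, h1] at h

theorem carriedTo_raise :
    CarriedTo (arcNext σ.perm) (raisePos σ.perm 0) (sweepPos σ.perm 0 1) ∧
      CarriedTo (arcNext σ.perm) (sweepPos σ.perm 0 1) (raisePos σ.perm 0) := by
  have h := carriedTo_symm_of_path (next := arcNext σ.perm) (F := raisePos σ.perm)
    (fun v => continuous_arcPos (fun i => by fun_prop) (fun i => by fun_prop)
      (fun i => by fun_prop) (fun i => by fun_prop) (fun i => by simp only [Pi.zero_apply]; fun_prop) v)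
    (fun t ht => isEmbedded_raisePos σ.isLorenzPerm ht)
  have h1 : raisePos σ.perm 1 = sweepPos σ.perm 0 1 := by
    funext ⟨i, j⟩
    fin_cases j <;> simp [raisePos, sweepPos, arcPos]
  rwa [h1] at h

theorem carriedTo_widen {ε : ℝ} (hε : |ε| = 1) :
    CarriedTo (arcNext σ.perm) (sweepPos σ.perm 0 ε) (sweepPos σ.perm 1 ε) ∧
      CarriedTo (arcNext σ.perm) (sweepPos σ.perm 1 ε) (sweepPos σ.perm 0 ε) :=
  carriedTo_symm_of_path (next := arcNext σ.perm) (F := fun t => sweepPos σ.perm t ε)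
    (fun v => continuous_arcPos (fun i => by fun_prop) (fun i => by split_ifs <;> fun_prop)
      (fun i => by fun_prop) (fun i => by split_ifs <;> fun_prop)
      (fun i => by split_ifs <;> fun_prop) v)
    (fun _ ht => isEmbedded_sweepPos σ.isLorenzPerm ht (Or.inl hε))

theorem carriedTo_cross :
    CarriedTo (arcNext σ.perm) (sweepPos σ.perm 1 1) (sweepPos σ.perm 1 (-1)) ∧
      CarriedTo (arcNext σ.perm) (sweepPos σ.perm 1 (-1)) (sweepPos σ.perm 1 1) := by
  have h := carriedTo_symm_of_path (next := arcNext σ.perm)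
    (F := fun t => sweepPos σ.perm 1 (1 - 2 * t))
    (fun v => continuous_arcPos (fun i => by fun_prop) (fun i => by fun_prop)
      (fun i => by split_ifs <;> fun_prop) (fun i => by fun_prop)
      (fun i => by fun_prop) v)
    (fun _ _ => isEmbedded_sweepPos σ.isLorenzPerm (by norm_num) (Or.inr rfl))
  norm_num at h
  exact h

theorem carriedTo_level :
    CarriedTo (arcNext σ.perm) (sweepPos σ.perm 0 (-1)) (levelPos σ.perm 1) ∧
      CarriedTo (arcNext σ.perm) (levelPos σ.perm 1) (sweepPos σ.perm 0 (-1)) := by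
  have h := carriedTo_symm_of_path (next := arcNext σ.perm) (F := levelPos σ.perm)
    (fun v => continuous_arcPos (fun i => by fun_prop) (fun i => by fun_prop)
      (fun i => by split_ifs <;> fun_prop) (fun i => by fun_prop)
      (fun i => by simp only [Pi.zero_apply]; fun_prop) v)
    (fun t ht => isEmbedded_levelPos σ.isLorenzPerm ht)
  have h1 : levelPos σ.perm 0 = sweepPos σ.perm 0 (-1) := by
    funext ⟨i, j⟩
    fin_cases j <;> simp [levelPos, sweepPos, arcPos]
  rwa [h1] at h

theorem carriedTo_translate :
    CarriedTo (arcNext σ.perm) (levelPos σ.perm 1) (permBraidPos σ.perm) ∧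
      CarriedTo (arcNext σ.perm) (permBraidPos σ.perm) (levelPos σ.perm 1) := by
  have h := carriedTo_symm_of_path (next := arcNext σ.perm)
    (F := fun t v => ((0, t, 0) : Space) + levelPos σ.perm 1 v)
    (fun v => by fun_prop)
    (fun t _ => (isEmbedded_levelPos σ.isLorenzPerm (by norm_num)).map
      (add_right_injective ((0, t, 0) : Space)) fun p q s => by
        rw [lineMap_coords, lineMap_coords]
        ext
        · simp
        · simp
          ring
        · simp)
  have h0 : (fun v => ((0, 0, 0) : Space) + levelPos σ.perm 1 v) = levelPos σ.perm 1 := by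
    funext v
    exact zero_add _
  have h1 : (fun v => ((0, 1, 0) : Space) + levelPos σ.perm 1 v) = permBraidPos σ.perm := by
    funext ⟨i, j⟩
    fin_cases j <;> simp [levelPos, arcPos, permBraidPos, strandHeight]
  rwa [h0, h1] at h

theorem diagonalLink_isotopic_lorenzLink : σ.diagonalLink.Isotopic σ.lorenzLink :=
  (σ.carriedTo_grid_raise.1.trans <| σ.carriedTo_raise.1.trans <|
    (σ.carriedTo_widen (by simp)).1.trans <| σ.carriedTo_cross.1.trans <|
    (σ.carriedTo_widen (by simp)).2.trans <| σ.carriedTo_level.1.trans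
    σ.carriedTo_translate.1).isotopic inferInstance σ.isEmbedded_grid σ.isEmbedded_permBraidPos

theorem lorenzLink_isotopic_diagonalLink : σ.lorenzLink.Isotopic σ.diagonalLink :=
  (σ.carriedTo_translate.2.trans <| σ.carriedTo_level.2.trans <|
    (σ.carriedTo_widen (by simp)).1.trans <| σ.carriedTo_cross.2.trans <|
    (σ.carriedTo_widen (by simp)).2.trans <| σ.carriedTo_raise.2.trans
    σ.carriedTo_grid_raise.2).isotopic inferInstance σ.isEmbedded_permBraidPos σ.isEmbedded_grid

end LorenzShuffle

/-! ### Shuffles with a given Lorenz vector -/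

namespace LorenzShuffle

theorem hasVector_iff {σ : LorenzShuffle} {v : List ℤ} :
    σ.HasVector v ↔ v.length ≤ σ.n ∧ IsShuffleAt σ.perm v.length ∧
      ∀ (i : ℕ) (hi : i < v.length) (hn : i < σ.n), ((σ.perm ⟨i, hn⟩ : ℕ) : ℤ) = i + v[i] := by
  constructor
  · rintro ⟨k, hk, rfl⟩
    have hl : ((List.ofFn fun i : Fin σ.n =>
        ((σ.perm i : ℕ) : ℤ) - ((i : ℕ) : ℤ)).take k).length = k := by
      simpa using hk.1
    refine ⟨by rw [hl]; exact hk.1, by rwa [hl], fun i hi hn => ?_⟩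
    simp
  · rintro ⟨hl, hk, h⟩
    refine ⟨v.length, hk, List.ext_getElem (by simpa using hl) fun i h1 h2 => ?_⟩
    have := h i h1 (by omega)
    simp
    omega

/-- The largest value of a shuffle without fixed points is attained at the end of the first block,
so that the Lorenz vector determines the number of permuted elements. -/
theorem HasVector.n_eq {σ : LorenzShuffle} {v : List ℤ} (h : σ.HasVector v) :
    (σ.n : ℤ) = v.length + v.getLastD 0 := by
  obtain ⟨hl, hk, hv⟩ := hasVector_iff.1 h
  rcases Nat.eq_zero_or_pos σ.n with h0 | h0
  · have : v = [] := List.length_eq_zero_iff.1 (by omega)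
    simp [this, h0]
  obtain ⟨i, hi⟩ := σ.perm.surjective ⟨σ.n - 1, by omega⟩
  have hi' : (σ.perm i : ℕ) = σ.n - 1 := by rw [hi]
  have hik : (i : ℕ) < v.length := by
    by_contra hc
    have := Fin.lt_def.1 (hk.apply_lt σ.perm_ne (not_lt.1 hc))
    omega
  have hie : (i : ℕ) = v.length - 1 := by
    by_contra hc
    have := Fin.lt_def.1 (hk.2.1 i ⟨v.length - 1, by omega⟩ (by rw [Fin.lt_def]; dsimp only; omega)
      (by dsimp only; omega))
    omega
  have h1 := hv i hik i.2
  have hne : v ≠ [] := by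
    rintro rfl
    simp at hik
  rw [List.getLastD_eq_getLast?, List.getLast?_eq_some_getLast hne, Option.getD_some,
    List.getLast_eq_getElem]
  simp only [hie] at h1
  have hi'' : (σ.perm ⟨v.length - 1, by omega⟩ : ℕ) = σ.n - 1 := by
    rw [← hi']
    congr 2
    exact Fin.ext hie.symm
  omega

/-- A shuffle is determined by its values on the first block. -/
theorem _root_.IsShuffleAt.eq_of_eqOn {n k : ℕ} {σ τ : Equiv.Perm (Fin n)} (hσ : IsShuffleAt σ k)
    (hτ : IsShuffleAt τ k) (h : ∀ i : Fin n, (i : ℕ) < k → σ i = τ i) : σ = τ := by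
  ext1 i
  induction i using WellFoundedLT.induction with
  | ind i ih =>
    by_contra hne
    have hik : k ≤ (i : ℕ) := by
      by_contra hc
      exact hne (h i (not_le.1 hc))
    -- the smaller one of the two values at `i` is not taken by the other shuffle
    have key : ∀ {α β : Equiv.Perm (Fin n)}, IsShuffleAt β k → (∀ j, j < i → α j = β j) →
        ¬ α i < β i := by
      intro α β hβ hj hlt
      rcases lt_trichotomy (β.symm (α i)) i with h1 | h1 | h1
      · have := hj _ h1
        rw [Equiv.apply_symm_apply] at this
        exact h1.ne (α.injective this)
      · rw [← h1, Equiv.apply_symm_apply, h1] at hlt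
        exact lt_irrefl _ hlt
      · have := hβ.2.2 _ _ h1 hik
        rw [Equiv.apply_symm_apply] at this
        exact lt_asymm hlt this
    rcases lt_or_gt_of_ne hne with h1 | h1
    · exact key hτ ih h1
    · exact key hσ (fun j hj => (ih j hj).symm) h1

theorem HasVector.unique {σ τ : LorenzShuffle} {v : List ℤ} (hσ : σ.HasVector v)
    (hτ : τ.HasVector v) : σ = τ := by
  have hn : σ.n = τ.n := by
    have h1 := hσ.n_eq
    have h2 := hτ.n_eq
    omega
  obtain ⟨hl, hk, hv⟩ := hasVector_iff.1 hσ
  obtain ⟨hl', hk', hv'⟩ := hasVector_iff.1 hτ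
  obtain ⟨n, p, hs, hp⟩ := σ
  obtain ⟨m, q, ht, hq⟩ := τ
  dsimp only at hn
  subst hn
  have : p = q := hk.eq_of_eqOn hk' fun i hi => by
    have h1 := hv i hi i.2
    have h2 := hv' i hi i.2
    exact Fin.ext (by exact_mod_cast h1.trans h2.symm)
  subst this
  rfl

theorem exists_hasVector {v : List ℤ} (hpos : ∀ x ∈ v, 0 < x) (hv : v.Pairwise (· ≤ ·)) :
    ∃ σ : LorenzShuffle, σ.HasVector v := by
  set m := v.length with hm
  -- the number of elements of the second block is the last entry of `v`
  obtain ⟨p, hp, hlast⟩ : ∃ p : ℕ, (∀ (i : ℕ) (hi : i < m), v[i] ≤ p) ∧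
      (0 < p → ∃ h : m - 1 < m, v[m - 1] = p) := by
    rcases Nat.eq_zero_or_pos m with h0 | h0
    · exact ⟨0, fun i hi => by omega, fun h => by omega⟩
    · have h1 : m - 1 < m := by omega
      refine ⟨v[m - 1].toNat, fun i hi => ?_, fun _ => ⟨h1, ?_⟩⟩
      · refine le_trans ?_ (Int.self_le_toNat _)
        rcases (show i ≤ m - 1 by omega).lt_or_eq with h2 | rfl
        · exact List.pairwise_iff_getElem.1 hv i (m - 1) hi h1 h2
        · exact le_rfl
      · have := hpos _ (List.getElem_mem h1)
        omega
  have hpos' : ∀ (i : ℕ) (hi : i < m), 0 < v[i] := fun i hi => hpos _ (List.getElem_mem hi)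
  let f : Fin m → Fin (m + p) := fun i => ⟨i + v[(i : ℕ)].toNat, by
    have := hp i i.2
    omega⟩
  have hf : StrictMono f := by
    intro i j hij
    have h1 := List.pairwise_iff_getElem.1 hv i j i.2 j.2 hij
    rw [Fin.lt_def] at hij ⊢
    dsimp only [f]
    omega
  let s : Finset (Fin (m + p)) := Finset.univ.map ⟨f, hf.injective⟩
  have hs : s.card = m := by simp [s]
  have hsc : sᶜ.card = p := by simp [Finset.card_compl, hs]
  let c := sᶜ.orderEmbOfFin hsc
  let τ : Equiv.Perm (Fin (m + p)) := finSumFinEquiv.symm.trans (finSumEquivOfFinset hs hsc)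
  have hτ1 : ∀ i : Fin m, τ (Fin.castAdd p i) = f i := by
    intro i
    have : f = s.orderEmbOfFin hs := Finset.orderEmbOfFin_unique hs (fun x => by simp [s]) hf
    simp [τ, ← this]
  have hτ2 : ∀ i : Fin p, τ (Fin.natAdd m i) = c i := by
    intro i
    simp [τ, c]
  -- the largest element belongs to the first block, so the values on the second one are small
  have hc : ∀ (r : ℕ) (hr : r < p), (c ⟨p - 1 - r, by omega⟩ : ℕ) + r + 2 ≤ m + p := by
    intro r
    induction r with
    | zero =>
      intro hr
      obtain ⟨h1, h2⟩ := hlast hr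
      have h3 : f ⟨m - 1, h1⟩ ≠ c ⟨p - 1 - 0, by omega⟩ := by
        intro e
        have h4 := sᶜ.orderEmbOfFin_mem hsc ⟨p - 1 - 0, by omega⟩
        rw [Finset.mem_compl] at h4
        refine h4 ?_
        rw [show sᶜ.orderEmbOfFin hsc ⟨p - 1 - 0, by omega⟩ = f ⟨m - 1, h1⟩ from e.symm]
        simp [s]
      have h5 : (f ⟨m - 1, h1⟩ : ℕ) = m - 1 + v[m - 1].toNat := rfl
      have h6 : (f ⟨m - 1, h1⟩ : ℕ) ≠ (c ⟨p - 1 - 0, by omega⟩ : ℕ) := fun e => h3 (Fin.ext e)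
      have h7 := (c ⟨p - 1 - 0, by omega⟩).2
      omega
    | succ r ih =>
      intro hr
      have h1 := ih (by omega)
      have h2 : c ⟨p - 1 - (r + 1), by omega⟩ < c ⟨p - 1 - r, by omega⟩ :=
        c.strictMono (by rw [Fin.lt_def]; dsimp only; omega)
      rw [Fin.lt_def] at h2
      omega
  have hshuffle : IsShuffleAt τ m := by
    refine ⟨by omega, fun i j hij hj => ?_, fun i j hij hi => ?_⟩
    · rw [Fin.lt_def] at hij
      have h1 := hτ1 ⟨i, by omega⟩
      have h2 := hτ1 ⟨j, hj⟩
      simp only [Fin.castAdd_mk, Fin.eta] at h1 h2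
      rw [h1, h2]
      exact hf hij
    · rw [Fin.lt_def] at hij
      have h1 := hτ2 ⟨i - m, by omega⟩
      have h2 := hτ2 ⟨j - m, by omega⟩
      simp only [Fin.natAdd_mk, Nat.add_sub_cancel' hi,
        Nat.add_sub_cancel' (hi.trans hij.le), Fin.eta] at h1 h2
      rw [h1, h2]
      exact c.strictMono (by rw [Fin.lt_def]; dsimp only; omega)
  refine ⟨⟨m + p, τ, ⟨m, hshuffle⟩, fun i => ?_⟩, hasVector_iff.2 ⟨?_, hshuffle, ?_⟩⟩
  · rcases lt_or_ge (i : ℕ) m with hi | hi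
    · have h1 := hτ1 ⟨i, hi⟩
      simp only [Fin.castAdd_mk, Fin.eta] at h1
      intro e
      have h2 : (f ⟨i, hi⟩ : ℕ) = i := by rw [← h1, e]
      have h3 := hpos' i hi
      dsimp only [f] at h2
      omega
    · have h1 := hτ2 ⟨i - m, by omega⟩
      simp only [Fin.natAdd_mk, Nat.add_sub_cancel' hi, Fin.eta] at h1
      intro e
      have h2 : (c ⟨i - m, by omega⟩ : ℕ) = i := by rw [← h1, e]
      have h3 := hc (p - 1 - (i - m)) (by omega)
      simp only [show p - 1 - (p - 1 - (i - m)) = (i : ℕ) - m by omega] at h3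
      omega
  · exact Nat.le_add_right _ _
  · intro i hi hn
    have h1 := hτ1 ⟨i, hi⟩
    simp only [Fin.castAdd_mk] at h1
    have h2 := hpos' i hi
    have h3 : (τ ⟨i, hn⟩ : ℕ) = i + v[i].toNat := by rw [h1]
    change ((τ ⟨i, hn⟩ : ℕ) : ℤ) = _
    omega

end LorenzShuffle

theorem powerVector_pos {s : ℕ} {p : Fin s → ℕ} (q : Fin s → ℕ) (hp : ∀ i, 0 < p i) :
    ∀ x ∈ powerVector p q, 0 < x := by
  intro x hx
  simp only [powerVector, List.mem_flatten, List.mem_ofFn] at hx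
  obtain ⟨_, ⟨i, rfl⟩, hx⟩ := hx
  rw [List.eq_of_mem_replicate hx]
  exact_mod_cast hp i

theorem pairwise_powerVector {s : ℕ} {p : Fin s → ℕ} (q : Fin s → ℕ) (hp : Monotone p) :
    (powerVector p q).Pairwise (· ≤ ·) := by
  rw [powerVector, List.pairwise_flatten]
  constructor
  · intro l hl
    obtain ⟨i, rfl⟩ := List.mem_ofFn.1 hl
    exact List.pairwise_replicate.2 (Or.inr le_rfl)
  · rw [List.pairwise_ofFn]
    intro i j hij x hx y hy
    rw [List.eq_of_mem_replicate hx, List.eq_of_mem_replicate hy]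
    exact_mod_cast hp hij.le

theorem theorem1 :
    {L : OrientedLink | IsDiagonalLink L} = {L : OrientedLink | IsLorenzLink L} ∧
    (∀ σ : LorenzShuffle, σ.diagonalLink.Isotopic σ.lorenzLink) ∧
    (∀ (s : ℕ) (p q : Fin s → ℕ), StrictMono p → (∀ i, 0 < p i) → (∀ i, 0 < q i) →
      (∃! σ : LorenzShuffle, σ.HasVector (powerVector p q)) ∧
      ∀ σ : LorenzShuffle, σ.HasVector (powerVector p q) →
        σ.diagonalLink.Isotopic σ.lorenzLink) := by
  refine ⟨Set.ext fun L => ⟨?_, ?_⟩, fun σ => σ.diagonalLink_isotopic_lorenzLink,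
    fun s p q hp hp0 _ => ⟨?_, fun σ _ => σ.diagonalLink_isotopic_lorenzLink⟩⟩
  · rintro ⟨σ, h⟩
    exact ⟨σ, h.trans σ.diagonalLink_isotopic_lorenzLink⟩
  · rintro ⟨σ, h⟩
    exact ⟨σ, h.trans σ.lorenzLink_isotopic_diagonalLink⟩
  · obtain ⟨σ, hσ⟩ := LorenzShuffle.exists_hasVector (powerVector_pos q hp0)
      (pairwise_powerVector q hp.monotone)
    exact ⟨σ, hσ, fun τ hτ => hτ.unique hσ⟩
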